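/- **Conventions.** Manifolds are smooth, finite-dimensional and real. $\mathbb X=[X_1\rightrightarrows X_0]$ is a Lie groupoid with source $s$ (a submersion), target $t$ and unit map $e$; $\gamma'\circ\gamma$ is defined when $s(\gamma')=t(\gamma)$. A *connection* on $\mathbb X$ is a smooth distribution $\mathcal H\subset TX_1$ such that (1) $\mathcal H\oplus\ker(ds)=TX_1$; (2) $de_x(T_xX_0)=\mathcal H_{e(x)}$ for all $x\in X_0$; (3) the maps $\theta_\gamma\colon T_{s(\gamma)}X_0\cong\mathcal H_\gamma\xrightarrow{dt}T_{t(\gamma)}X_0$ satisfy $\theta_{\gamma'}\circ\theta_\gamma=\theta_{\gamma'\circ\gamma}$. Let $G$ be a Lie group with Lie algebra $\mathfrak g$. A *principal $G$-bundle over $\mathbb X$* is a (right) principal $G$-bundle $\pi\colon E_G\to X_0$ with a smooth left action $\mu\colon s^*E_G=\{(\gamma,a): s(\gamma)=\pi(a)\}\to E_G$, $(\gamma,a)\mapsto\gamma\cdot a$, of $\mathbb X$ over $\pi$ that commutes with the action of $G$. It gives the Lie groupoid $[s^*E_G\rightrightarrows E_G]$ with source $(\gamma,a)\mapsto a$ and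 target $\mu$, and on $s^*E_G$ the pulled-back distribution $\widetilde{\mathcal H}=(d\,\mathrm{pr}_1)^{-1}(\mathcal H)$, which is a complement of the kernel of the differential of the source map. Let $\widetilde\theta_{(\gamma,a)}\colon T_aE_G\cong\widetilde{\mathcal H}_{(\gamma,a)}\xrightarrow{d\mu}T_{\gamma\cdot a}E_G$. An arrow $\gamma$ acts on $TX_0$ by $\theta_\gamma$, on $\mathrm{At}(E_G)=TE_G/G$ by $\gamma\cdot[v]=[\widetilde\theta_{(\gamma,a)}(v)]$ for $v\in T_aE_G$, $\pi(a)=s(\gamma)$, and on $\mathrm{ad}(E_G)=\ker(d\pi)/G\subset\mathrm{At}(E_G)$ by restriction. The Atiyah sequence is $0\to\mathrm{ad}(E_G)\to\mathrm{At}(E_G)\xrightarrow{d\pi}TX_0\to0$. A *vector bundle over $\mathbb X$* is a vector bundle over $X_0$ with a smooth action of $\mathbb X$ by linear maps of the fibres. A vector bundle homomorphism $\mathcal D\colon\mathrm{At}(E_G)\to\mathrm{ad}(E_G)$ is an *$\mathbb X$-equivariant splitting* if it restricts to the identity on $\mathrm{ad}(E_G)$ and $\mathcal D(\gamma\cdot\xi)=\gamma\cdot\mathcal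 D(\xi)$ whenever $\xi$ lies over $s(\gamma)$. It is a *connection on $(E_G\to X_0,\mathbb X)$*, i.e. a splitting of the Atiyah sequence of vector bundles over $\mathbb X$, if moreover $TX_0$, $\mathrm{At}(E_G)$ and $\mathrm{ad}(E_G)$, with the operations above, are vector bundles over $\mathbb X$. A $\mathfrak g$-valued $1$-form $\omega$ on $E_G$ is a *form on the Lie groupoid $[s^*E_G\rightrightarrows E_G]$* (with respect to $\widetilde{\mathcal H}$) if $$(\mathrm{pr}_2^*\omega)\circ P_{\widetilde{\mathcal H}}=(\mu^*\omega)\circ P_{\widetilde{\mathcal H}},$$ where $P_{\widetilde{\mathcal H}}$ is the projection of $T(s^*E_G)$ onto $\widetilde{\mathcal H}$ along the kernel of the differential of the source map. **Lemma.** Let $(E_G\xrightarrow{\pi}X_0,\ \mathbb X=[X_1\rightrightarrows X_0])$ be a principal $G$-bundle over a Lie groupoid $\mathbb X$ with a connection $\mathcal H$. Let $\omega$ be a connection $1$-form on the principal $G$-bundle $E_G\to X_0$ (that is, a smooth $\mathfrak g$-valued $1$-form with $\omega(\frac{d}{d\tau}|_{\tau=0}\,a\exp(\tau A))=A$ for $A\in\mathfrak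 g$ and $R_g^*\omega=\mathrm{Ad}_{g^{-1}}\circ\omega$), and let $\mathcal D\colon\mathrm{At}(E_G)\to\mathrm{ad}(E_G)$ be the corresponding homomorphism, which sends $[v]$, $v\in T_aE_G$, to the class of the vertical vector at $a$ generated by $\omega(v)$. Then the following are equivalent: 1. $\mathcal D$ is a connection on $(E_G\xrightarrow{\pi}X_0,\mathbb X)$; 2. $\mathcal D$ is an $\mathbb X$-equivariant splitting of the Atiyah sequence; 3. $\omega$ is a $\mathfrak g$-valued $1$-form on the Lie groupoid $[s^*E_G\rightrightarrows E_G]$. -/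

import Mathlib

open scoped Manifold ContDiff Topology
open Manifold

set_option linter.unusedSectionVars false

section FiberProduct

variable {EA : Type*} [NormedAddCommGroup EA] [NormedSpace ℝ EA]
  {EB : Type*} [NormedAddCommGroup EB] [NormedSpace ℝ EB]
  {EC : Type*} [NormedAddCommGroup EC] [NormedSpace ℝ EC]
  {A : Type*} [TopologicalSpace A] [ChartedSpace EA A]
  {B : Type*} [TopologicalSpace B] [ChartedSpace EB B]
  {C : Type*} [TopologicalSpace C] [ChartedSpace EC C]
  {f : A → C} {g : B → C}

/-- The fibre product `A ×_C B` of a submersion `f : A → C` and a smooth map `g : B → C`. -/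
def FiberProduct (_hf : IsSubmersion 𝓘(ℝ, EA) 𝓘(ℝ, EC) ∞ f)
    (_hg : ContMDiff 𝓘(ℝ, EB) 𝓘(ℝ, EC) ∞ g) : Type _ :=
  {p : A × B // f p.1 = g p.2}

namespace FiberProduct

variable {hf : IsSubmersion 𝓘(ℝ, EA) 𝓘(ℝ, EC) ∞ f} {hg : ContMDiff 𝓘(ℝ, EB) 𝓘(ℝ, EC) ∞ g}

instance : TopologicalSpace (FiberProduct hf hg) :=
  inferInstanceAs (TopologicalSpace {p : A × B // f p.1 = g p.2})

/-- The point `(a, b)` of the fibre product. -/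
def mk (a : A) (b : B) (h : f a = g b) : FiberProduct hf hg := ⟨(a, b), h⟩

/-- The projection to the first factor. -/
def fst (p : FiberProduct hf hg) : A := p.1.1

/-- The projection to the second factor. -/
def snd (p : FiberProduct hf hg) : B := p.1.2

theorem condition (p : FiberProduct hf hg) : f p.fst = g p.snd := p.2

@[simp] theorem fst_mk (a : A) (b : B) (h : f a = g b) :
    (mk a b h : FiberProduct hf hg).fst = a := rfl

@[simp] theorem snd_mk (a : A) (b : B) (h : f a = g b) :
    (mk a b h : FiberProduct hf hg).snd = b := rfl

@[ext] theorem ext {p q : FiberProduct hf hg} (h₁ : p.fst = q.fst) (h₂ : p.snd = q.snd) : p = q :=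
  Subtype.ext (Prod.ext h₁ h₂)

theorem isInducing_val :
    Topology.IsInducing (fun p : FiberProduct hf hg => (p.fst, p.snd)) := Topology.IsInducing.subtypeVal

theorem continuous_fst : Continuous (fst : FiberProduct hf hg → A) :=
  _root_.continuous_fst.comp continuous_subtype_val

theorem continuous_snd : Continuous (snd : FiberProduct hf hg → B) :=
  _root_.continuous_snd.comp continuous_subtype_val

/-- Submersion charts of `f` around `a`. -/
theorem submersionAt (hf : IsSubmersion 𝓘(ℝ, EA) 𝓘(ℝ, EC) ∞ f) (a : A) :
    IsSubmersionAtOfComplement hf.complement 𝓘(ℝ, EA) 𝓘(ℝ, EC) ∞ f a :=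
  hf.isSubmersionOfComplement_complement a

theorem codChart_apply (hf : IsSubmersion 𝓘(ℝ, EA) 𝓘(ℝ, EC) ∞ f) (a : A) {x : A}
    (hx : x ∈ (submersionAt hf a).domChart.source) :
    (submersionAt hf a).codChart (f x)
      = ((submersionAt hf a).equiv ((submersionAt hf a).domChart x)).1 := by
  have h1 : (submersionAt hf a).domChart x ∈
      ((submersionAt hf a).domChart.extend 𝓘(ℝ, EA)).target := by
    simpa using (submersionAt hf a).domChart.map_source hx
  have h2 := (submersionAt hf a).writtenInCharts h1
  simpa [OpenPartialHomeomorph.left_inv _ hx] using h2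

/-- The first coordinate of the point of the fibre product with given chart coordinates. -/
noncomputable def chartInvFst (hf : IsSubmersion 𝓘(ℝ, EA) 𝓘(ℝ, EC) ∞ f) (g : B → C)
    (a : A) (b : B) (q : hf.complement × EB) : A :=
  (submersionAt hf a).domChart.symm ((submersionAt hf a).equiv.symm
    ((submersionAt hf a).codChart (g ((chartAt EB b).symm q.2)), q.1))

/-- The range of the chart of the fibre product around `(a, b)`. -/
def chartTarget (hf : IsSubmersion 𝓘(ℝ, EA) 𝓘(ℝ, EC) ∞ f) (g : B → C)
    (a : A) (b : B) : Set (hf.complement × EB) :=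
  {q | (q.2 ∈ (chartAt EB b).target ∧
      g ((chartAt EB b).symm q.2) ∈ (submersionAt hf a).codChart.source) ∧
      (submersionAt hf a).equiv.symm
        ((submersionAt hf a).codChart (g ((chartAt EB b).symm q.2)), q.1)
        ∈ (submersionAt hf a).domChart.target}

theorem chartInv_condition (a : A) (b : B) {q : hf.complement × EB} (hq : q ∈ chartTarget hf g a b) :
    f (chartInvFst hf g a b q) = g ((chartAt EB b).symm q.2) := by
  obtain ⟨⟨h1, h2⟩, h3⟩ := hq
  have hx := (submersionAt hf a).domChart.map_target h3
  refine (submersionAt hf a).codChart.injOn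
    ((submersionAt hf a).mapsto_domChart_source_codChart_source hx) h2 ?_
  rw [codChart_apply hf a hx, OpenPartialHomeomorph.right_inv _ h3]
  simp

theorem continuousOn_chartInv_aux (hg : ContMDiff 𝓘(ℝ, EB) 𝓘(ℝ, EC) ∞ g) (a : A) (b : B) :
    ContinuousOn (fun q : hf.complement × EB => (submersionAt hf a).equiv.symm
        ((submersionAt hf a).codChart (g ((chartAt EB b).symm q.2)), q.1))
      {q | q.2 ∈ (chartAt EB b).target ∧
      g ((chartAt EB b).symm q.2) ∈ (submersionAt hf a).codChart.source} := by
  refine (submersionAt hf a).equiv.symm.continuous.comp_continuousOn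
    (ContinuousOn.prodMk ?_ _root_.continuous_fst.continuousOn)
  refine (submersionAt hf a).codChart.continuousOn.comp
    (t := (submersionAt hf a).codChart.source) ?_ fun q hq => hq.2
  refine hg.continuous.comp_continuousOn ?_
  exact (chartAt EB b).continuousOn_symm.comp _root_.continuous_snd.continuousOn fun q hq => hq.1

theorem isOpen_chartTarget_aux (hg : ContMDiff 𝓘(ℝ, EB) 𝓘(ℝ, EC) ∞ g) (a : A) (b : B) :
    IsOpen {q : hf.complement × EB | q.2 ∈ (chartAt EB b).target ∧
      g ((chartAt EB b).symm q.2) ∈ (submersionAt hf a).codChart.source} := by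
  have h1 : ContinuousOn (fun q : hf.complement × EB => g ((chartAt EB b).symm q.2))
      {q | q.2 ∈ (chartAt EB b).target} := by
    refine hg.continuous.comp_continuousOn ?_
    exact (chartAt EB b).continuousOn_symm.comp _root_.continuous_snd.continuousOn fun q hq => hq
  exact h1.isOpen_inter_preimage ((chartAt EB b).open_target.preimage _root_.continuous_snd)
    (submersionAt hf a).codChart.open_source

open Classical in
/-- The chart of the fibre product around `(a, b)` given by a submersion chart of `f` around `a` and a chart
of `B` around `b`. -/
noncomputable def chart (p₀ : FiberProduct hf hg) :
    OpenPartialHomeomorph (FiberProduct hf hg) (hf.complement × EB) where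
  toFun p := (((submersionAt hf p₀.fst).equiv ((submersionAt hf p₀.fst).domChart p.fst)).2,
    chartAt EB p₀.snd p.snd)
  invFun q := if h : f (chartInvFst hf g p₀.fst p₀.snd q) = g ((chartAt EB p₀.snd).symm q.2) then
    mk _ _ h else p₀
  source := {p | p.fst ∈ (submersionAt hf p₀.fst).domChart.source ∧
    p.snd ∈ (chartAt EB p₀.snd).source}
  target := chartTarget hf g p₀.fst p₀.snd
  map_source' := by
    rintro p ⟨h1, h2⟩
    have h3 : (submersionAt hf p₀.fst).codChart (g p.snd) =
      ((submersionAt hf p₀.fst).equiv ((submersionAt hf p₀.fst).domChart p.fst)).1 := by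
      rw [← p.condition]; exact codChart_apply hf _ h1
    refine ⟨⟨(chartAt EB p₀.snd).map_source h2, ?_⟩, ?_⟩
    · simp only [OpenPartialHomeomorph.left_inv _ h2]
      rw [← p.condition]
      exact (submersionAt hf p₀.fst).mapsto_domChart_source_codChart_source h1
    · simp only [OpenPartialHomeomorph.left_inv _ h2, h3]
      simpa using (submersionAt hf p₀.fst).domChart.map_source h1
  map_target' := by
    intro q hq
    rw [dif_pos (chartInv_condition _ _ hq)]
    exact ⟨(submersionAt hf p₀.fst).domChart.map_target hq.2,
      (chartAt EB p₀.snd).map_target hq.1.1⟩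
  left_inv' := by
    rintro p ⟨h1, h2⟩
    have h3 : (submersionAt hf p₀.fst).codChart (g p.snd) =
      ((submersionAt hf p₀.fst).equiv ((submersionAt hf p₀.fst).domChart p.fst)).1 := by
      rw [← p.condition]; exact codChart_apply hf _ h1
    have h4 : chartInvFst hf g p₀.fst p₀.snd
        (((submersionAt hf p₀.fst).equiv ((submersionAt hf p₀.fst).domChart p.fst)).2,
        chartAt EB p₀.snd p.snd) = p.fst := by
      simp only [chartInvFst, OpenPartialHomeomorph.left_inv _ h2, h3]
      simp [OpenPartialHomeomorph.left_inv _ h1]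
    have h5 := OpenPartialHomeomorph.left_inv (chartAt EB p₀.snd) h2
    rw [dif_pos (by rw [h4]; simp only [h5]; exact p.condition)]
    exact FiberProduct.ext h4 h5
  right_inv' := by
    intro q hq
    rw [dif_pos (chartInv_condition _ _ hq)]
    refine Prod.ext ?_ ((chartAt EB p₀.snd).right_inv hq.1.1)
    simp only [fst_mk, chartInvFst]
    rw [OpenPartialHomeomorph.right_inv _ hq.2]
    simp
  open_source := ((submersionAt hf p₀.fst).domChart.open_source.preimage continuous_fst).inter
    ((chartAt EB p₀.snd).open_source.preimage continuous_snd)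
  open_target := (continuousOn_chartInv_aux hg _ _).isOpen_inter_preimage (isOpen_chartTarget_aux hg _ _)
    (submersionAt hf p₀.fst).domChart.open_target
  continuousOn_toFun := by
    refine ContinuousOn.prodMk ?_ ?_
    · refine (_root_.continuous_snd.comp (submersionAt hf p₀.fst).equiv.continuous).comp_continuousOn ?_
      exact (submersionAt hf p₀.fst).domChart.continuousOn.comp continuous_fst.continuousOn
        fun p hp => hp.1
    · exact (chartAt EB p₀.snd).continuousOn.comp continuous_snd.continuousOn fun p hp => hp.2
  continuousOn_invFun := by
    classical
    rw [isInducing_val.continuousOn_iff]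
    have : ContinuousOn (fun q : hf.complement × EB =>
        (chartInvFst hf g p₀.fst p₀.snd q, (chartAt EB p₀.snd).symm q.2))
        (chartTarget hf g p₀.fst p₀.snd) := by
      refine ContinuousOn.prodMk ?_ ?_
      · exact (submersionAt hf p₀.fst).domChart.continuousOn_symm.comp
          ((continuousOn_chartInv_aux hg _ _).mono fun q hq => hq.1) fun q hq => hq.2
      · exact (chartAt EB p₀.snd).continuousOn_symm.comp _root_.continuous_snd.continuousOn
          fun q hq => hq.1.1
    refine this.congr fun q hq => ?_
    simp only [Function.comp_apply]
    rw [dif_pos (chartInv_condition _ _ hq)]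
    rfl

noncomputable instance : ChartedSpace (hf.complement × EB) (FiberProduct hf hg) where
  atlas := Set.range chart
  chartAt := chart
  mem_chart_source p := ⟨(submersionAt hf p.fst).mem_domChart_source, mem_chart_source EB p.snd⟩
  chart_mem_atlas p := ⟨p, rfl⟩


theorem chartAt_apply (p₀ p : FiberProduct hf hg) :
    chartAt (hf.complement × EB) p₀ p =
      (((submersionAt hf p₀.fst).equiv ((submersionAt hf p₀.fst).domChart p.fst)).2,
        chartAt EB p₀.snd p.snd) := rfl

theorem fst_chart_symm (p₀ : FiberProduct hf hg) {q : hf.complement × EB}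
    (hq : q ∈ chartTarget hf g p₀.fst p₀.snd) :
    ((chart p₀).symm q).fst = chartInvFst hf g p₀.fst p₀.snd q := by
  classical
  have : (chart p₀).symm q = mk _ _ (chartInv_condition _ _ hq) := dif_pos (chartInv_condition _ _ hq)
  rw [this]; rfl

theorem snd_chart_symm (p₀ : FiberProduct hf hg) {q : hf.complement × EB}
    (hq : q ∈ chartTarget hf g p₀.fst p₀.snd) :
    ((chart p₀).symm q).snd = (chartAt EB p₀.snd).symm q.2 := by
  classical
  have : (chart p₀).symm q = mk _ _ (chartInv_condition _ _ hq) := dif_pos (chartInv_condition _ _ hq)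
  rw [this]; rfl

theorem contMDiffOn_snd_chart_symm [IsManifold 𝓘(ℝ, EB) ∞ B] (p₀ : FiberProduct hf hg) :
    ContMDiffOn 𝓘(ℝ, hf.complement × EB) 𝓘(ℝ, EB) ∞ (fun q => ((chart p₀).symm q).snd)
      (chartTarget hf g p₀.fst p₀.snd) := by
  have h1 : ContMDiffOn 𝓘(ℝ, hf.complement × EB) 𝓘(ℝ, EB) ∞
      (fun q : hf.complement × EB => (chartAt EB p₀.snd).symm q.2)
      (chartTarget hf g p₀.fst p₀.snd) :=
    (contMDiffOn_chart_symm (x := p₀.snd)).comp (contDiff_snd.contMDiff.contMDiffOn)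
      fun q hq => hq.1.1
  exact h1.congr fun q hq => snd_chart_symm p₀ hq

theorem contMDiffOn_fst_chart_symm [IsManifold 𝓘(ℝ, EA) ∞ A] [IsManifold 𝓘(ℝ, EB) ∞ B]
    [IsManifold 𝓘(ℝ, EC) ∞ C] (p₀ : FiberProduct hf hg) :
    ContMDiffOn 𝓘(ℝ, hf.complement × EB) 𝓘(ℝ, EA) ∞ (fun q => ((chart p₀).symm q).fst)
      (chartTarget hf g p₀.fst p₀.snd) := by
  have h1 : ContMDiffOn 𝓘(ℝ, hf.complement × EB) 𝓘(ℝ, EB) ∞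
      (fun q : hf.complement × EB => (chartAt EB p₀.snd).symm q.2)
      (chartTarget hf g p₀.fst p₀.snd) :=
    (contMDiffOn_chart_symm (x := p₀.snd)).comp (contDiff_snd.contMDiff.contMDiffOn)
      fun q hq => hq.1.1
  have h2 := (contMDiffOn_of_mem_maximalAtlas
    (submersionAt hf p₀.fst).codChart_mem_maximalAtlas).comp (hg.comp_contMDiffOn h1)
      fun q hq => hq.1.2
  have h3 := h2.prodMk_space (contDiff_fst.contMDiff.contMDiffOn (f := Prod.fst))
  have h4 := (submersionAt hf p₀.fst).equiv.symm.contDiff.contMDiff.comp_contMDiffOn h3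
  have h5 := (contMDiffOn_symm_of_mem_maximalAtlas
    (submersionAt hf p₀.fst).domChart_mem_maximalAtlas).comp h4 fun q hq => hq.2
  exact h5.congr fun q hq => fst_chart_symm p₀ hq

theorem contMDiffOn_chart_aux [IsManifold 𝓘(ℝ, EA) ∞ A] [IsManifold 𝓘(ℝ, EB) ∞ B]
    {EN : Type*} [NormedAddCommGroup EN] [NormedSpace ℝ EN]
    {N : Type*} [TopologicalSpace N] [ChartedSpace EN N] (p₀ : FiberProduct hf hg)
    {s : Set N} {u : N → FiberProduct hf hg}
    (h₁ : ContMDiffOn 𝓘(ℝ, EN) 𝓘(ℝ, EA) ∞ (fun x => (u x).fst) s)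
    (h₂ : ContMDiffOn 𝓘(ℝ, EN) 𝓘(ℝ, EB) ∞ (fun x => (u x).snd) s)
    (hs : ∀ x ∈ s, u x ∈ (chart p₀).source) :
    ContMDiffOn 𝓘(ℝ, EN) 𝓘(ℝ, hf.complement × EB) ∞ (fun x => chart p₀ (u x)) s := by
  have h3 := (contMDiffOn_of_mem_maximalAtlas
    (submersionAt hf p₀.fst).domChart_mem_maximalAtlas).comp h₁ fun x hx => (hs x hx).1
  have h4 := (contDiff_snd.comp (submersionAt hf p₀.fst).equiv.contDiff).contMDiff.comp_contMDiffOn h3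
  have h5 := (contMDiffOn_chart (x := p₀.snd)).comp h₂ fun x hx => (hs x hx).2
  exact h4.prodMk_space h5

instance [IsManifold 𝓘(ℝ, EA) ∞ A] [IsManifold 𝓘(ℝ, EB) ∞ B] [IsManifold 𝓘(ℝ, EC) ∞ C] :
    IsManifold 𝓘(ℝ, hf.complement × EB) ∞ (FiberProduct hf hg) := by
  refine isManifold_of_contDiffOn _ _ _ ?_
  rintro _ _ ⟨p, rfl⟩ ⟨q, rfl⟩
  have := contMDiffOn_chart_aux q (u := (chart p).symm) (s := (chart p).target ∩ (chart p).symm ⁻¹' (chart q).source)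
    ((contMDiffOn_fst_chart_symm p).mono fun x hx => hx.1)
    ((contMDiffOn_snd_chart_symm p).mono fun x hx => hx.1) (fun x hx => hx.2)
  rw [contMDiffOn_iff_contDiffOn] at this
  refine (this.mono ?_).congr ?_
  · rintro x hx
    simpa using hx
  · intro x hx
    rfl

variable [IsManifold 𝓘(ℝ, EA) ∞ A] [IsManifold 𝓘(ℝ, EB) ∞ B] [IsManifold 𝓘(ℝ, EC) ∞ C]

theorem contMDiff_fst :
    ContMDiff 𝓘(ℝ, hf.complement × EB) 𝓘(ℝ, EA) ∞ (fst : FiberProduct hf hg → A) := by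
  intro p
  have h := (contMDiffOn_fst_chart_symm p).comp (contMDiffOn_chart (x := p)) fun x hx => (chart p).map_source hx
  refine (h.congr fun x hx => ?_).contMDiffAt ((chart p).open_source.mem_nhds (mem_chart_source _ p))
  exact congrArg fst ((chart p).left_inv hx).symm

theorem contMDiff_snd :
    ContMDiff 𝓘(ℝ, hf.complement × EB) 𝓘(ℝ, EB) ∞ (snd : FiberProduct hf hg → B) := by
  intro p
  have h := (contMDiffOn_snd_chart_symm p).comp (contMDiffOn_chart (x := p)) fun x hx => (chart p).map_source hx
  refine (h.congr fun x hx => ?_).contMDiffAt ((chart p).open_source.mem_nhds (mem_chart_source _ p))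
  exact congrArg snd ((chart p).left_inv hx).symm

theorem contMDiffOn_iff {EN : Type*} [NormedAddCommGroup EN] [NormedSpace ℝ EN]
    {N : Type*} [TopologicalSpace N] [ChartedSpace EN N] [IsManifold 𝓘(ℝ, EN) ∞ N]
    {u : N → FiberProduct hf hg} {U : Set N} :
    ContMDiffOn 𝓘(ℝ, EN) 𝓘(ℝ, hf.complement × EB) ∞ u U ↔
      ContMDiffOn 𝓘(ℝ, EN) 𝓘(ℝ, EA) ∞ (fun x => (u x).fst) U ∧
      ContMDiffOn 𝓘(ℝ, EN) 𝓘(ℝ, EB) ∞ (fun x => (u x).snd) U := by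
  refine ⟨fun h => ⟨contMDiff_fst.comp_contMDiffOn h, contMDiff_snd.comp_contMDiffOn h⟩, ?_⟩
  rintro ⟨h₁, h₂⟩ x hx
  have hc : ContinuousOn u U := by
    rw [isInducing_val.continuousOn_iff]
    exact h₁.continuousOn.prodMk h₂.continuousOn
  have hV : u ⁻¹' (chart (u x)).source ∈ 𝓝[U] x :=
    (hc x hx).preimage_mem_nhdsWithin ((chart (u x)).open_source.mem_nhds (mem_chart_source _ (u x)))
  have h3 := contMDiffOn_chart_aux (u x) (u := u) (s := U ∩ u ⁻¹' (chart (u x)).source)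
    (h₁.mono Set.inter_subset_left) (h₂.mono Set.inter_subset_left) (fun y hy => hy.2)
  have h4 := (contMDiffOn_chart_symm (x := u x)).comp h3 fun y hy => (chart (u x)).map_source hy.2
  have h5 := (h4.congr (f₁ := u) fun y hy => ((chart (u x)).left_inv hy.2).symm) x
    ⟨hx, mem_chart_source (hf.complement × EB) (u x)⟩
  exact h5.mono_of_mem_nhdsWithin (Filter.inter_mem self_mem_nhdsWithin hV)

theorem contMDiff_mk {EN : Type*} [NormedAddCommGroup EN] [NormedSpace ℝ EN]
    {N : Type*} [TopologicalSpace N] [ChartedSpace EN N] [IsManifold 𝓘(ℝ, EN) ∞ N]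
    {a : N → A} {b : N → B} (ha : ContMDiff 𝓘(ℝ, EN) 𝓘(ℝ, EA) ∞ a)
    (hb : ContMDiff 𝓘(ℝ, EN) 𝓘(ℝ, EB) ∞ b) (h : ∀ x, f (a x) = g (b x)) :
    ContMDiff 𝓘(ℝ, EN) 𝓘(ℝ, hf.complement × EB) ∞
      (fun x => (mk (a x) (b x) (h x) : FiberProduct hf hg)) := by
  rw [← contMDiffOn_univ, contMDiffOn_iff]
  exact ⟨ha.contMDiffOn, hb.contMDiffOn⟩


theorem ne_zero_aux : (∞ : WithTop ℕ∞) ≠ 0 := by simp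

theorem condition_mfderiv (p : FiberProduct hf hg)
    (z : TangentSpace 𝓘(ℝ, hf.complement × EB) p) :
    mfderiv 𝓘(ℝ, EA) 𝓘(ℝ, EC) f p.fst
        (mfderiv 𝓘(ℝ, hf.complement × EB) 𝓘(ℝ, EA) fst p z) =
      mfderiv 𝓘(ℝ, EB) 𝓘(ℝ, EC) g p.snd
        (mfderiv 𝓘(ℝ, hf.complement × EB) 𝓘(ℝ, EB) snd p z) := by
  have h1 := mfderiv_comp_apply p (hf.contMDiff.mdifferentiable ne_zero_aux p.fst)
    (contMDiff_fst.mdifferentiable ne_zero_aux p) z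
  have h2 := mfderiv_comp_apply p (hg.mdifferentiable ne_zero_aux p.snd)
    (contMDiff_snd.mdifferentiable ne_zero_aux p) z
  have h3 : f ∘ (fst : FiberProduct hf hg → A) = g ∘ snd := funext condition
  rw [h3] at h1
  exact h1.symm.trans h2

theorem mfderiv_clm_comp {E F : Type*} [NormedAddCommGroup E] [NormedSpace ℝ E]
    [NormedAddCommGroup F] [NormedSpace ℝ F] (l : E →L[ℝ] F) {φ : A → E} {a : A}
    (hφ : MDifferentiableAt 𝓘(ℝ, EA) 𝓘(ℝ, E) φ a) (u : TangentSpace 𝓘(ℝ, EA) a) :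
    mfderiv 𝓘(ℝ, EA) 𝓘(ℝ, F) (fun x => l (φ x)) a u = l (mfderiv 𝓘(ℝ, EA) 𝓘(ℝ, E) φ a u) := by
  have h := mfderiv_comp_apply a (l.contMDiff.mdifferentiable one_ne_zero (φ a)) hφ u
  exact h.trans (congrArg (fun T : E →L[ℝ] F => T (mfderiv 𝓘(ℝ, EA) 𝓘(ℝ, E) φ a u))
    (l.mfderiv_eq (x := φ a)))

theorem mdifferentiableAt_vertical_coord (hf : IsSubmersion 𝓘(ℝ, EA) 𝓘(ℝ, EC) ∞ f) (a : A) :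
    MDifferentiableAt 𝓘(ℝ, EA) 𝓘(ℝ, hf.complement)
      (fun x => ((submersionAt hf a).equiv ((submersionAt hf a).domChart x)).2) a := by
  have h := contMDiffAt_of_mem_maximalAtlas (submersionAt hf a).domChart_mem_maximalAtlas
    (submersionAt hf a).mem_domChart_source
  exact ((contDiff_snd.comp (submersionAt hf a).equiv.contDiff).contMDiff.contMDiffAt.comp _
    h).mdifferentiableAt ne_zero_aux

theorem mdifferentiableAt_chart (b : B) :
    MDifferentiableAt 𝓘(ℝ, EB) 𝓘(ℝ, EB) (chartAt EB b) b :=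
  mdifferentiableAt_atlas (chart_mem_atlas _ _) (mem_chart_source _ _)

theorem mdifferentiableAt_domChart (hf : IsSubmersion 𝓘(ℝ, EA) 𝓘(ℝ, EC) ∞ f) (a : A) :
    MDifferentiableAt 𝓘(ℝ, EA) 𝓘(ℝ, EA) (submersionAt hf a).domChart a :=
  (contMDiffAt_of_mem_maximalAtlas (submersionAt hf a).domChart_mem_maximalAtlas
    (submersionAt hf a).mem_domChart_source).mdifferentiableAt ne_zero_aux

theorem mdifferentiableAt_codChart (hf : IsSubmersion 𝓘(ℝ, EA) 𝓘(ℝ, EC) ∞ f) (a : A) :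
    MDifferentiableAt 𝓘(ℝ, EC) 𝓘(ℝ, EC) (submersionAt hf a).codChart (f a) :=
  (contMDiffAt_of_mem_maximalAtlas (submersionAt hf a).codChart_mem_maximalAtlas
    (submersionAt hf a).mem_codChart_source).mdifferentiableAt ne_zero_aux

/-- A tangent vector is determined by its image under the submersion and its image under the vertical
coordinate of a submersion chart. -/
theorem eq_of_mfderiv_eq (hf : IsSubmersion 𝓘(ℝ, EA) 𝓘(ℝ, EC) ∞ f) (a : A)
    {v w : TangentSpace 𝓘(ℝ, EA) a}
    (h₁ : mfderiv 𝓘(ℝ, EA) 𝓘(ℝ, EC) f a v = mfderiv 𝓘(ℝ, EA) 𝓘(ℝ, EC) f a w)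
    (h₂ : mfderiv 𝓘(ℝ, EA) 𝓘(ℝ, hf.complement)
        (fun x => ((submersionAt hf a).equiv ((submersionAt hf a).domChart x)).2) a v =
      mfderiv 𝓘(ℝ, EA) 𝓘(ℝ, hf.complement)
        (fun x => ((submersionAt hf a).equiv ((submersionAt hf a).domChart x)).2) a w) :
    v = w := by
  have hφ := mdifferentiableAt_domChart hf a
  have hmem := (submersionAt hf a).mem_domChart_source
  have hD : (submersionAt hf a).domChart.MDifferentiable 𝓘(ℝ, EA) 𝓘(ℝ, EA) :=
    ⟨(contMDiffOn_of_mem_maximalAtlas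
      (submersionAt hf a).domChart_mem_maximalAtlas).mdifferentiableOn ne_zero_aux,
    (contMDiffOn_symm_of_mem_maximalAtlas
      (submersionAt hf a).domChart_mem_maximalAtlas).mdifferentiableOn ne_zero_aux⟩
  apply hD.mfderiv_injective hmem
  apply (submersionAt hf a).equiv.injective
  have hfst : ∀ u : TangentSpace 𝓘(ℝ, EA) a,
      ((submersionAt hf a).equiv
        (mfderiv 𝓘(ℝ, EA) 𝓘(ℝ, EA) (submersionAt hf a).domChart a u)).1 =
      mfderiv 𝓘(ℝ, EC) 𝓘(ℝ, EC) (submersionAt hf a).codChart (f a)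
        (mfderiv 𝓘(ℝ, EA) 𝓘(ℝ, EC) f a u) := by
    intro u
    have h3 : (submersionAt hf a).codChart ∘ f =ᶠ[𝓝 a]
        fun x => ((ContinuousLinearMap.fst ℝ EC hf.complement) ∘L
          ((submersionAt hf a).equiv : EA →L[ℝ] EC × hf.complement))
            ((submersionAt hf a).domChart x) := by
      filter_upwards [(submersionAt hf a).domChart.open_source.mem_nhds hmem] with x hx
      exact codChart_apply hf a hx
    have h4 := mfderiv_clm_comp ((ContinuousLinearMap.fst ℝ EC hf.complement) ∘L
          ((submersionAt hf a).equiv : EA →L[ℝ] EC × hf.complement)) hφ u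
    have h5 := mfderiv_comp_apply a (mdifferentiableAt_codChart hf a)
      (hf.contMDiff.mdifferentiable ne_zero_aux a) u
    rw [h3.mfderiv_eq] at h5
    exact h4.symm.trans h5
  have hsnd : ∀ u : TangentSpace 𝓘(ℝ, EA) a,
      ((submersionAt hf a).equiv
        (mfderiv 𝓘(ℝ, EA) 𝓘(ℝ, EA) (submersionAt hf a).domChart a u)).2 =
      mfderiv 𝓘(ℝ, EA) 𝓘(ℝ, hf.complement)
        (fun x => ((submersionAt hf a).equiv ((submersionAt hf a).domChart x)).2) a u :=
    fun u => (mfderiv_clm_comp ((ContinuousLinearMap.snd ℝ EC hf.complement) ∘L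
          ((submersionAt hf a).equiv : EA →L[ℝ] EC × hf.complement)) hφ u).symm
  refine Prod.ext ?_ ?_
  · exact (hfst v).trans ((congrArg _ h₁).trans (hfst w).symm)
  · exact (hsnd v).trans (h₂.trans (hsnd w).symm)

theorem mfderiv_submersion_surjective (hf : IsSubmersion 𝓘(ℝ, EA) 𝓘(ℝ, EC) ∞ f) (a : A) :
    Function.Surjective (mfderiv 𝓘(ℝ, EA) 𝓘(ℝ, EC) f a) := by
  set k := ((submersionAt hf a).equiv ((submersionAt hf a).domChart a)).2 with hk
  have h0 : (submersionAt hf a).equiv.symm ((submersionAt hf a).codChart (f a), k) =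
      (submersionAt hf a).domChart a := by
    rw [codChart_apply hf a (submersionAt hf a).mem_domChart_source, hk]; simp
  let σ : C → A := fun c => (submersionAt hf a).domChart.symm
    ((submersionAt hf a).equiv.symm ((submersionAt hf a).codChart c, k))
  have hσa : σ (f a) = a := by
    simp only [σ, h0]
    exact (submersionAt hf a).domChart.left_inv (submersionAt hf a).mem_domChart_source
  have hin : ContMDiffAt 𝓘(ℝ, EC) 𝓘(ℝ, EA) ∞ (fun c => (submersionAt hf a).equiv.symm
      ((submersionAt hf a).codChart c, k)) (f a) := by
    refine (submersionAt hf a).equiv.symm.contDiff.contMDiff.contMDiffAt.comp _ ?_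
    exact (contMDiffAt_of_mem_maximalAtlas (submersionAt hf a).codChart_mem_maximalAtlas
      (submersionAt hf a).mem_codChart_source).prodMk_space contMDiffAt_const
  have htgt : (submersionAt hf a).domChart a ∈ (submersionAt hf a).domChart.target :=
    (submersionAt hf a).domChart.map_source (submersionAt hf a).mem_domChart_source
  have hσ : ContMDiffAt 𝓘(ℝ, EC) 𝓘(ℝ, EA) ∞ σ (f a) := by
    have h1 := contMDiffAt_symm_of_mem_maximalAtlas
      (submersionAt hf a).domChart_mem_maximalAtlas htgt
    rw [← h0] at h1
    exact ContMDiffAt.comp (f := fun c => (submersionAt hf a).equiv.symm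
      ((submersionAt hf a).codChart c, k)) (f a) h1 hin
  have hid : f ∘ σ =ᶠ[𝓝 (f a)] id := by
    have e1 : ∀ᶠ c in 𝓝 (f a), (submersionAt hf a).equiv.symm
        ((submersionAt hf a).codChart c, k) ∈ (submersionAt hf a).domChart.target :=
      hin.continuousAt.eventually_mem (by
        rw [h0]; exact (submersionAt hf a).domChart.open_target.mem_nhds htgt)
    filter_upwards [e1, (submersionAt hf a).codChart.open_source.mem_nhds
      (submersionAt hf a).mem_codChart_source] with c hc hc'
    have hx := (submersionAt hf a).domChart.map_target hc
    refine (submersionAt hf a).codChart.injOn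
      ((submersionAt hf a).mapsto_domChart_source_codChart_source hx) hc' ?_
    refine (codChart_apply hf a hx).trans ?_
    rw [OpenPartialHomeomorph.right_inv _ hc]
    simp
  intro w
  have hfσ : MDifferentiableAt 𝓘(ℝ, EA) 𝓘(ℝ, EC) f (σ (f a)) :=
    hf.contMDiff.mdifferentiable ne_zero_aux _
  have h := mfderiv_comp_apply (f a) hfσ (hσ.mdifferentiableAt ne_zero_aux) w
  rw [hid.mfderiv_eq, mfderiv_id] at h
  refine ⟨mfderiv 𝓘(ℝ, EC) 𝓘(ℝ, EA) σ (f a) w, ?_⟩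
  rw [hσa] at h
  exact h.symm

theorem mfderiv_injective (p : FiberProduct hf hg)
    {z z' : TangentSpace 𝓘(ℝ, hf.complement × EB) p}
    (h₁ : mfderiv 𝓘(ℝ, hf.complement × EB) 𝓘(ℝ, EA) fst p z =
      mfderiv 𝓘(ℝ, hf.complement × EB) 𝓘(ℝ, EA) fst p z')
    (h₂ : mfderiv 𝓘(ℝ, hf.complement × EB) 𝓘(ℝ, EB) snd p z =
      mfderiv 𝓘(ℝ, hf.complement × EB) 𝓘(ℝ, EB) snd p z') : z = z' := by
  have hD := mdifferentiable_chart (I := 𝓘(ℝ, hf.complement × EB)) p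
  apply hD.mfderiv_injective (mem_chart_source _ p)
  have hκ := hD.mdifferentiableAt (mem_chart_source _ p)
  have hone : ∀ u : TangentSpace 𝓘(ℝ, hf.complement × EB) p,
      ((mfderiv 𝓘(ℝ, hf.complement × EB) 𝓘(ℝ, hf.complement × EB)
        (chartAt (hf.complement × EB) p) p u : hf.complement × EB)).1 =
      mfderiv 𝓘(ℝ, EA) 𝓘(ℝ, hf.complement)
        (fun x => ((submersionAt hf p.fst).equiv ((submersionAt hf p.fst).domChart x)).2) p.fst
        (mfderiv 𝓘(ℝ, hf.complement × EB) 𝓘(ℝ, EA) fst p u) := by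
    intro u
    have h1 := mfderiv_comp_apply p (mdifferentiableAt_vertical_coord hf p.fst)
      (contMDiff_fst.mdifferentiable ne_zero_aux p) u
    exact (mfderiv_clm_comp (ContinuousLinearMap.fst ℝ hf.complement EB) hκ u).symm.trans h1
  have htwo : ∀ u : TangentSpace 𝓘(ℝ, hf.complement × EB) p,
      ((mfderiv 𝓘(ℝ, hf.complement × EB) 𝓘(ℝ, hf.complement × EB)
        (chartAt (hf.complement × EB) p) p u : hf.complement × EB)).2 =
      mfderiv 𝓘(ℝ, EB) 𝓘(ℝ, EB) (chartAt EB p.snd) p.snd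
        (mfderiv 𝓘(ℝ, hf.complement × EB) 𝓘(ℝ, EB) snd p u) := by
    intro u
    have h1 := mfderiv_comp_apply p (mdifferentiableAt_chart p.snd)
      (contMDiff_snd.mdifferentiable ne_zero_aux p) u
    exact (mfderiv_clm_comp (ContinuousLinearMap.snd ℝ hf.complement EB) hκ u).symm.trans h1
  refine Prod.ext ?_ ?_
  · exact (hone z).trans ((congrArg _ h₁).trans (hone z').symm)
  · exact (htwo z).trans ((congrArg _ h₂).trans (htwo z').symm)

/-- Tangent vectors of the two factors with the same image lift to the fibre product. -/
theorem exists_mfderiv_eq (p : FiberProduct hf hg) (v : TangentSpace 𝓘(ℝ, EA) p.fst)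
    (w : TangentSpace 𝓘(ℝ, EB) p.snd)
    (h : mfderiv 𝓘(ℝ, EA) 𝓘(ℝ, EC) f p.fst v = mfderiv 𝓘(ℝ, EB) 𝓘(ℝ, EC) g p.snd w) :
    ∃ z : TangentSpace 𝓘(ℝ, hf.complement × EB) p,
      mfderiv 𝓘(ℝ, hf.complement × EB) 𝓘(ℝ, EA) fst p z = v ∧
      mfderiv 𝓘(ℝ, hf.complement × EB) 𝓘(ℝ, EB) snd p z = w := by
  have hmem := mem_chart_source (hf.complement × EB) p
  have hD := mdifferentiable_chart (I := 𝓘(ℝ, hf.complement × EB)) p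
  have hv := mdifferentiableAt_vertical_coord hf p.fst
  have hχ := mdifferentiableAt_chart (EB := EB) p.snd
  have hκ := hD.mdifferentiableAt hmem
  let v' : hf.complement := mfderiv 𝓘(ℝ, EA) 𝓘(ℝ, hf.complement)
    (fun x => ((submersionAt hf p.fst).equiv ((submersionAt hf p.fst).domChart x)).2) p.fst v
  let w' : EB := mfderiv 𝓘(ℝ, EB) 𝓘(ℝ, EB) (chartAt EB p.snd) p.snd w
  obtain ⟨z, hz⟩ := hD.mfderiv_surjective hmem (show hf.complement × EB from (v', w'))
  have h1 : mfderiv 𝓘(ℝ, EA) 𝓘(ℝ, hf.complement)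
      (fun x => ((submersionAt hf p.fst).equiv ((submersionAt hf p.fst).domChart x)).2) p.fst
      (mfderiv 𝓘(ℝ, hf.complement × EB) 𝓘(ℝ, EA) fst p z) = v' := by
    have h1 := mfderiv_comp_apply p hv (contMDiff_fst.mdifferentiable ne_zero_aux p) z
    have h2 := mfderiv_clm_comp (ContinuousLinearMap.fst ℝ hf.complement EB) hκ z
    exact h1.symm.trans (h2.trans (congrArg (fun q : hf.complement × EB => q.1) hz))
  have h2 : mfderiv 𝓘(ℝ, EB) 𝓘(ℝ, EB) (chartAt EB p.snd) p.snd
      (mfderiv 𝓘(ℝ, hf.complement × EB) 𝓘(ℝ, EB) snd p z) = w' := by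
    have h1 := mfderiv_comp_apply p hχ (contMDiff_snd.mdifferentiable ne_zero_aux p) z
    have h2 := mfderiv_clm_comp (ContinuousLinearMap.snd ℝ hf.complement EB) hκ z
    exact h1.symm.trans (h2.trans (congrArg (fun q : hf.complement × EB => q.2) hz))
  have h3 : mfderiv 𝓘(ℝ, hf.complement × EB) 𝓘(ℝ, EB) snd p z = w :=
    (mdifferentiable_chart (I := 𝓘(ℝ, EB)) p.snd).mfderiv_injective (mem_chart_source _ _) h2
  refine ⟨z, eq_of_mfderiv_eq hf p.fst ?_ h1, h3⟩
  rw [condition_mfderiv, h3, h]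

end FiberProduct
end FiberProduct

section Groupoid

/-- A Lie groupoid with manifold of arrows `X₁` and manifold of objects `X₀`. The composite
`m (γ', γ) = γ' ∘ γ` is defined when `s γ' = t γ`. -/
structure LieGroupoid (E₁ E₀ X₁ X₀ : Type*) [NormedAddCommGroup E₁] [NormedSpace ℝ E₁]
    [NormedAddCommGroup E₀] [NormedSpace ℝ E₀] [TopologicalSpace X₁] [ChartedSpace E₁ X₁]
    [TopologicalSpace X₀] [ChartedSpace E₀ X₀] where
  /-- source -/
  s : X₁ → X₀
  /-- target -/
  t : X₁ → X₀
  s_submersion : IsSubmersion 𝓘(ℝ, E₁) 𝓘(ℝ, E₀) ∞ s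
  t_smooth : ContMDiff 𝓘(ℝ, E₁) 𝓘(ℝ, E₀) ∞ t
  /-- multiplication -/
  m : FiberProduct s_submersion t_smooth → X₁
  m_smooth : ContMDiff 𝓘(ℝ, s_submersion.complement × E₁) 𝓘(ℝ, E₁) ∞ m
  /-- identity section -/
  e : X₀ → X₁
  e_smooth : ContMDiff 𝓘(ℝ, E₀) 𝓘(ℝ, E₁) ∞ e
  /-- inversion -/
  i : X₁ → X₁
  i_smooth : ContMDiff 𝓘(ℝ, E₁) 𝓘(ℝ, E₁) ∞ i
  s_m : ∀ c, s (m c) = s c.snd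
  t_m : ∀ c, t (m c) = t c.fst
  s_e : ∀ x, s (e x) = x
  t_e : ∀ x, t (e x) = x
  s_i : ∀ γ, s (i γ) = t γ
  t_i : ∀ γ, t (i γ) = s γ
  m_assoc : ∀ (a b c : X₁) (hab : s a = t b) (hbc : s b = t c),
    m (.mk (m (.mk a b hab)) c ((s_m (.mk a b hab)).trans hbc)) =
      m (.mk a (m (.mk b c hbc)) (hab.trans (t_m (.mk b c hbc)).symm))
  e_m : ∀ γ, m (.mk (e (t γ)) γ (s_e _)) = γ
  m_e : ∀ γ, m (.mk γ (e (s γ)) (t_e _).symm) = γ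
  i_m : ∀ γ, m (.mk (i γ) γ (s_i γ)) = e (s γ)
  m_i : ∀ γ, m (.mk γ (i γ) (t_i γ).symm) = e (t γ)

variable {E₁ : Type*} [NormedAddCommGroup E₁] [NormedSpace ℝ E₁]
  {E₀ : Type*} [NormedAddCommGroup E₀] [NormedSpace ℝ E₀]
  {EP : Type*} [NormedAddCommGroup EP] [NormedSpace ℝ EP]
  {EG : Type*} [NormedAddCommGroup EG] [NormedSpace ℝ EG]
  {X₁ : Type*} [TopologicalSpace X₁] [ChartedSpace E₁ X₁] [IsManifold 𝓘(ℝ, E₁) ∞ X₁]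
  {X₀ : Type*} [TopologicalSpace X₀] [ChartedSpace E₀ X₀] [IsManifold 𝓘(ℝ, E₀) ∞ X₀]
  {P : Type*} [TopologicalSpace P] [ChartedSpace EP P] [IsManifold 𝓘(ℝ, EP) ∞ P]
  {G : Type*} [TopologicalSpace G] [ChartedSpace EG G] [Group G] [LieGroup 𝓘(ℝ, EG) ∞ G]

namespace LieGroupoid

/-- A family `H` of complements of the kernels of `ds` in the tangent spaces of the manifold of
arrows. -/
structure SourceComplement (𝒳 : LieGroupoid E₁ E₀ X₁ X₀) where
  /-- the subspace at an arrow -/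
  H : ∀ γ : X₁, Submodule ℝ (TangentSpace 𝓘(ℝ, E₁) γ)
  isCompl : ∀ γ, IsCompl (H γ) (mfderiv 𝓘(ℝ, E₁) 𝓘(ℝ, E₀) 𝒳.s γ).ker

namespace SourceComplement

variable {𝒳 : LieGroupoid E₁ E₀ X₁ X₀} (ℋ : 𝒳.SourceComplement)

/-- The projection `P_H` onto `H` along `ker ds`. -/
noncomputable def proj (γ : X₁) : TangentSpace 𝓘(ℝ, E₁) γ →ₗ[ℝ] TangentSpace 𝓘(ℝ, E₁) γ :=
  (ℋ.H γ).projection _ (ℋ.isCompl γ)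

theorem bijective (γ : X₁) : Function.Bijective
    ((mfderiv 𝓘(ℝ, E₁) 𝓘(ℝ, E₀) 𝒳.s γ).toLinearMap.domRestrict (ℋ.H γ)) := by
  constructor
  · rw [← LinearMap.ker_eq_bot, LinearMap.ker_domRestrict]
    exact Submodule.disjoint_iff_comap_eq_bot.mp (ℋ.isCompl γ).disjoint
  · intro w
    obtain ⟨v, rfl⟩ := FiberProduct.mfderiv_submersion_surjective 𝒳.s_submersion γ w
    obtain ⟨h, hh, k, hk, rfl⟩ := Submodule.mem_sup.mp
      ((ℋ.isCompl γ).sup_eq_top ▸ Submodule.mem_top : v ∈ ℋ.H γ ⊔ _)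
    refine ⟨⟨h, hh⟩, ?_⟩
    have hk' : mfderiv 𝓘(ℝ, E₁) 𝓘(ℝ, E₀) 𝒳.s γ k = 0 := hk
    simp [hk']

/-- The horizontal lift `T_{s γ} X₀ ≃ H_γ ⊆ T_γ X₁`, inverse to the restriction of `ds`. -/
noncomputable def lift (γ : X₁) : TangentSpace 𝓘(ℝ, E₀) (𝒳.s γ) →ₗ[ℝ] TangentSpace 𝓘(ℝ, E₁) γ :=
  (ℋ.H γ).subtype ∘ₗ (LinearEquiv.ofBijective _ (ℋ.bijective γ)).symm.toLinearMap

theorem lift_mem (γ : X₁) (v : TangentSpace 𝓘(ℝ, E₀) (𝒳.s γ)) : ℋ.lift γ v ∈ ℋ.H γ :=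
  Subtype.property _

theorem mfderiv_lift (γ : X₁) (v : TangentSpace 𝓘(ℝ, E₀) (𝒳.s γ)) :
    mfderiv 𝓘(ℝ, E₁) 𝓘(ℝ, E₀) 𝒳.s γ (ℋ.lift γ v) = v :=
  (LinearEquiv.ofBijective _ (ℋ.bijective γ)).apply_symm_apply v

theorem eq_lift {γ : X₁} {v : TangentSpace 𝓘(ℝ, E₀) (𝒳.s γ)} {h : TangentSpace 𝓘(ℝ, E₁) γ}
    (hh : h ∈ ℋ.H γ) (hv : mfderiv 𝓘(ℝ, E₁) 𝓘(ℝ, E₀) 𝒳.s γ h = v) : h = ℋ.lift γ v := by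
  have := (ℋ.bijective γ).1 (a₁ := ⟨h, hh⟩) (a₂ := ⟨ℋ.lift γ v, ℋ.lift_mem γ v⟩)
    (hv.trans (ℋ.mfderiv_lift γ v).symm)
  exact congrArg Subtype.val this

/-- The map `θ_γ : T_{s γ} X₀ → T_{t γ} X₀`, the horizontal lift followed by `dt`. -/
noncomputable def θ (γ : X₁) :
    TangentSpace 𝓘(ℝ, E₀) (𝒳.s γ) →ₗ[ℝ] TangentSpace 𝓘(ℝ, E₀) (𝒳.t γ) :=
  (mfderiv 𝓘(ℝ, E₁) 𝓘(ℝ, E₀) 𝒳.t γ).toLinearMap ∘ₗ ℋ.lift γ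

end SourceComplement

/-- A connection on a Lie groupoid: a smooth distribution complementary to `ker ds` (smooth in the
sense that the projection of `T X₁` onto it is smooth) which is `T X₀` along the identity section
and for which `θ` is multiplicative. In the last condition tangent vectors at `s (γ' ∘ γ) = s γ` are written as
elements of the model space. -/
structure Connection (𝒳 : LieGroupoid E₁ E₀ X₁ X₀) extends SourceComplement 𝒳 where
  smooth : ContMDiff 𝓘(ℝ, E₁).tangent 𝓘(ℝ, E₁).tangent ∞
    (fun v : TangentBundle 𝓘(ℝ, E₁) X₁ =>
      (⟨v.1, toSourceComplement.proj v.1 v.2⟩ : TangentBundle 𝓘(ℝ, E₁) X₁))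
  unit : ∀ x, (mfderiv 𝓘(ℝ, E₀) 𝓘(ℝ, E₁) 𝒳.e x).range = H (𝒳.e x)
  mult : ∀ (γ' γ : X₁) (h : 𝒳.s γ' = 𝒳.t γ) (v : E₀),
    (toSourceComplement.θ γ' (toSourceComplement.θ γ v : E₀) : E₀) =
      toSourceComplement.θ (𝒳.m (.mk γ' γ h)) v

/-- The horizontal component of a `W`-valued `1`-form on the manifold of arrows. -/
noncomputable def SourceComplement.horizontal {𝒳 : LieGroupoid E₁ E₀ X₁ X₀} (ℋ : 𝒳.SourceComplement)
    {W : Type*} [AddCommGroup W] [Module ℝ W]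
    (φ : ∀ γ : X₁, TangentSpace 𝓘(ℝ, E₁) γ →ₗ[ℝ] W) :
    ∀ γ : X₁, TangentSpace 𝓘(ℝ, E₁) γ →ₗ[ℝ] W :=
  fun γ => φ γ ∘ₗ ℋ.proj γ

/-- A `W`-valued `1`-form `φ` on the manifold of objects is a form on the Lie groupoid, with
respect to `H`, if `s^* φ` and `t^* φ` have the same horizontal component. -/
def IsForm (𝒳 : LieGroupoid E₁ E₀ X₁ X₀) (ℋ : 𝒳.SourceComplement)
    {W : Type*} [AddCommGroup W] [Module ℝ W]
    (φ : ∀ x : X₀, TangentSpace 𝓘(ℝ, E₀) x →ₗ[ℝ] W) : Prop :=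
  ℋ.horizontal (fun γ => φ (𝒳.s γ) ∘ₗ (mfderiv 𝓘(ℝ, E₁) 𝓘(ℝ, E₀) 𝒳.s γ).toLinearMap) =
    ℋ.horizontal (fun γ => φ (𝒳.t γ) ∘ₗ (mfderiv 𝓘(ℝ, E₁) 𝓘(ℝ, E₀) 𝒳.t γ).toLinearMap)

end LieGroupoid

/-- A right principal `G`-bundle `π : P → X₀`. Local trivialisations over an open set `U` are given as
the pair of smooth maps `p ↦ (π p, φ p)` and `ψ`, inverse to each other, between `π⁻¹ U` and
`U × G`. -/
structure PrincipalBundle (EP E₀ EG P X₀ G : Type*) [NormedAddCommGroup EP] [NormedSpace ℝ EP]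
    [NormedAddCommGroup E₀] [NormedSpace ℝ E₀] [NormedAddCommGroup EG] [NormedSpace ℝ EG]
    [TopologicalSpace P] [ChartedSpace EP P] [TopologicalSpace X₀] [ChartedSpace E₀ X₀]
    [TopologicalSpace G] [ChartedSpace EG G] [Group G] where
  /-- bundle projection -/
  π : P → X₀
  π_smooth : ContMDiff 𝓘(ℝ, EP) 𝓘(ℝ, E₀) ∞ π
  /-- right action of the structure group -/
  act : P → G → P
  act_smooth : ContMDiff (𝓘(ℝ, EP).prod 𝓘(ℝ, EG)) 𝓘(ℝ, EP) ∞ (fun q : P × G => act q.1 q.2)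
  act_one : ∀ a, act a 1 = a
  act_mul : ∀ a g h, act a (g * h) = act (act a g) h
  π_act : ∀ a g, π (act a g) = π a
  locally_trivial : ∀ x₀ : X₀, ∃ U : Set X₀, IsOpen U ∧ x₀ ∈ U ∧ ∃ (φ : P → G) (ψ : X₀ × G → P),
    ContMDiffOn 𝓘(ℝ, EP) 𝓘(ℝ, EG) ∞ φ (π ⁻¹' U) ∧
    ContMDiffOn (𝓘(ℝ, E₀).prod 𝓘(ℝ, EG)) 𝓘(ℝ, EP) ∞ ψ (U ×ˢ Set.univ) ∧
    (∀ a, π a ∈ U → ψ (π a, φ a) = a) ∧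
    (∀ x ∈ U, ∀ g, π (ψ (x, g)) = x ∧ φ (ψ (x, g)) = g) ∧
    (∀ a, π a ∈ U → ∀ g, φ (act a g) = φ a * g)

namespace PrincipalBundle

variable (𝒬 : PrincipalBundle EP E₀ EG P X₀ G)

theorem π_surjective : Function.Surjective 𝒬.π := by
  intro x
  obtain ⟨U, -, hx, φ, ψ, -, -, -, h, -⟩ := 𝒬.locally_trivial x
  exact ⟨ψ (x, 1), (h x hx 1).1⟩

theorem free {a : P} {g : G} (h : 𝒬.act a g = a) : g = 1 := by
  obtain ⟨U, -, hx, φ, ψ, -, -, -, -, h'⟩ := 𝒬.locally_trivial (𝒬.π a)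
  have := h' a hx g
  rw [h] at this
  exact mul_eq_left.mp this.symm

theorem transitive {a b : P} (h : 𝒬.π a = 𝒬.π b) : ∃ g, 𝒬.act a g = b := by
  obtain ⟨U, -, hx, φ, ψ, -, -, h₁, -, h₂⟩ := 𝒬.locally_trivial (𝒬.π a)
  refine ⟨(φ a)⁻¹ * φ b, ?_⟩
  rw [← h₁ (𝒬.act a ((φ a)⁻¹ * φ b)) (by rwa [𝒬.π_act]), h₂ a hx, 𝒬.π_act, mul_inv_cancel_left, h,
    h₁ b (h ▸ hx)]

theorem act_act_inv (a : P) (g : G) : 𝒬.act (𝒬.act a g⁻¹) g = a := by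
  rw [← 𝒬.act_mul, inv_mul_cancel, 𝒬.act_one]

theorem act_inv_act (a : P) (g : G) : 𝒬.act (𝒬.act a g) g⁻¹ = a := by
  rw [← 𝒬.act_mul, mul_inv_cancel, 𝒬.act_one]

/-- Right translation `R_g : P → P`. -/
def R (g : G) (a : P) : P := 𝒬.act a g

theorem R_smooth (g : G) : ContMDiff 𝓘(ℝ, EP) 𝓘(ℝ, EP) ∞ (𝒬.R g) :=
  𝒬.act_smooth.comp (contMDiff_id.prodMk contMDiff_const)

theorem orbit_smooth (a : P) : ContMDiff 𝓘(ℝ, EG) 𝓘(ℝ, EP) ∞ (𝒬.act a) :=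
  𝒬.act_smooth.comp (contMDiff_const.prodMk contMDiff_id)

/-- The differential `dR_g : T_a P → T_{a g} P`. -/
noncomputable def dR (g : G) (a : P) :
    TangentSpace 𝓘(ℝ, EP) a →L[ℝ] TangentSpace 𝓘(ℝ, EP) (𝒬.act a g) :=
  mfderiv 𝓘(ℝ, EP) 𝓘(ℝ, EP) (𝒬.R g) a

/-- The differential `T_a P → T_x X₀` of `π` at a point `a` over `x`. -/
noncomputable def dπ (a : P) (x : X₀) (_h : 𝒬.π a = x) :
    TangentSpace 𝓘(ℝ, EP) a →ₗ[ℝ] TangentSpace 𝓘(ℝ, E₀) x :=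
  (mfderiv 𝓘(ℝ, EP) 𝓘(ℝ, E₀) 𝒬.π a).toLinearMap

/-- The infinitesimal action `𝔤 → T_a P`, the differential of the orbit map `g ↦ a g`. -/
noncomputable def ζ (a : P) : GroupLieAlgebra 𝓘(ℝ, EG) G →ₗ[ℝ] TangentSpace 𝓘(ℝ, EP) a :=
  (mfderiv 𝓘(ℝ, EG) 𝓘(ℝ, EP) (𝒬.act a) 1).toLinearMap

theorem dR_one (a : P) (v : TangentSpace 𝓘(ℝ, EP) a) : (𝒬.dR 1 a v : EP) = v := by
  have h : 𝒬.R 1 = id := funext 𝒬.act_one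
  have : mfderiv 𝓘(ℝ, EP) 𝓘(ℝ, EP) (𝒬.R 1) a v = mfderiv 𝓘(ℝ, EP) 𝓘(ℝ, EP) id a v := by rw [h]
  exact this.trans (by rw [mfderiv_id]; rfl)

theorem dR_mul (g h : G) (a : P) (v : TangentSpace 𝓘(ℝ, EP) a) :
    (𝒬.dR (g * h) a v : EP) = 𝒬.dR h (𝒬.act a g) (𝒬.dR g a v) := by
  have e : 𝒬.R (g * h) = 𝒬.R h ∘ 𝒬.R g := funext fun b => 𝒬.act_mul b g h
  have : mfderiv 𝓘(ℝ, EP) 𝓘(ℝ, EP) (𝒬.R (g * h)) a v =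
      mfderiv 𝓘(ℝ, EP) 𝓘(ℝ, EP) (𝒬.R h ∘ 𝒬.R g) a v := by rw [e]
  exact this.trans (mfderiv_comp_apply a
    ((𝒬.R_smooth h).mdifferentiable FiberProduct.ne_zero_aux _)
    ((𝒬.R_smooth g).mdifferentiable FiberProduct.ne_zero_aux _) v)

theorem dπ_dR (g : G) (a : P) (x : X₀) (h : 𝒬.π a = x) (h' : 𝒬.π (𝒬.act a g) = x)
    (v : TangentSpace 𝓘(ℝ, EP) a) : 𝒬.dπ (𝒬.act a g) x h' (𝒬.dR g a v) = 𝒬.dπ a x h v := by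
  have e : 𝒬.π ∘ 𝒬.R g = 𝒬.π := funext fun b => 𝒬.π_act b g
  have h1 : mfderiv 𝓘(ℝ, EP) 𝓘(ℝ, E₀) (𝒬.π ∘ 𝒬.R g) a v = mfderiv 𝓘(ℝ, EP) 𝓘(ℝ, E₀) 𝒬.π a v := by
    rw [e]
  exact (mfderiv_comp_apply a
    (𝒬.π_smooth.mdifferentiable FiberProduct.ne_zero_aux _)
    ((𝒬.R_smooth g).mdifferentiable FiberProduct.ne_zero_aux _) v).symm.trans h1

theorem dπ_ζ (a : P) (x : X₀) (h : 𝒬.π a = x) (A : GroupLieAlgebra 𝓘(ℝ, EG) G) :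
    𝒬.dπ a x h (𝒬.ζ a A) = 0 := by
  have e : 𝒬.π ∘ 𝒬.act a = fun _ => 𝒬.π a := funext fun g => 𝒬.π_act a g
  have h1 : mfderiv 𝓘(ℝ, EG) 𝓘(ℝ, E₀) (𝒬.π ∘ 𝒬.act a) 1 A = (0 : E₀) := by
    rw [e, mfderiv_const]; rfl
  have h2 := mfderiv_comp_apply (1 : G)
    (𝒬.π_smooth.mdifferentiable FiberProduct.ne_zero_aux (𝒬.act a 1))
    ((𝒬.orbit_smooth a).mdifferentiable FiberProduct.ne_zero_aux 1) A
  rw [h1] at h2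
  have key : ∀ b, b = a → ∀ v : EP, mfderiv 𝓘(ℝ, EP) 𝓘(ℝ, E₀) 𝒬.π b v = (0 : E₀) →
      mfderiv 𝓘(ℝ, EP) 𝓘(ℝ, E₀) 𝒬.π a v = (0 : E₀) := by
    rintro b rfl v hv; exact hv
  exact key _ (𝒬.act_one a) _ h2.symm

/-- Tangent vectors of `P` at points over `x`. -/
abbrev TangentOver (x : X₀) : Type _ := {v : TangentBundle 𝓘(ℝ, EP) P // 𝒬.π v.1 = x}

/-- Two tangent vectors are equivalent if they are related by the differential of some right
translation. -/
def orbitRel (x : X₀) : Setoid (𝒬.TangentOver x) where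
  r v w := ∃ g : G, (⟨𝒬.act v.1.1 g, 𝒬.dR g v.1.1 v.1.2⟩ : TangentBundle 𝓘(ℝ, EP) P) = w.1
  iseqv := by
    have hone : ∀ v : TangentBundle 𝓘(ℝ, EP) P,
        (⟨𝒬.act v.1 1, 𝒬.dR 1 v.1 v.2⟩ : TangentBundle 𝓘(ℝ, EP) P) = v := by
      rintro ⟨a, v⟩
      have key : ∀ b, b = a → ∀ w : EP, w = v → (⟨b, w⟩ : TangentBundle 𝓘(ℝ, EP) P) = ⟨a, v⟩ := by
        rintro b rfl w rfl; rfl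
      exact key _ (𝒬.act_one a) _ (𝒬.dR_one a v)
    have hmul : ∀ (v : TangentBundle 𝓘(ℝ, EP) P) (g h : G),
        (⟨𝒬.act (𝒬.act v.1 g) h, 𝒬.dR h (𝒬.act v.1 g) (𝒬.dR g v.1 v.2)⟩ :
          TangentBundle 𝓘(ℝ, EP) P) = ⟨𝒬.act v.1 (g * h), 𝒬.dR (g * h) v.1 v.2⟩ := by
      rintro ⟨a, v⟩ g h
      have key : ∀ b c : P, b = c → ∀ w u : EP, w = u →
          (⟨b, w⟩ : TangentBundle 𝓘(ℝ, EP) P) = ⟨c, u⟩ := by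
        rintro b _ rfl w _ rfl; rfl
      exact key _ _ (𝒬.act_mul a g h).symm _ _ (𝒬.dR_mul g h a v).symm
    refine ⟨fun v => ⟨1, hone _⟩, ?_, ?_⟩
    · rintro ⟨v, hv⟩ ⟨w, hw⟩ ⟨g, hg⟩
      refine ⟨g⁻¹, ?_⟩
      subst hg
      refine (hmul v g g⁻¹).trans ?_
      rw [mul_inv_cancel]
      exact hone v
    · rintro ⟨v, hv⟩ ⟨w, hw⟩ ⟨u, hu⟩ ⟨g, hg⟩ ⟨h, hh⟩
      refine ⟨g * h, ?_⟩
      subst hg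
      subst hh
      exact (hmul v g h).symm

/-- The fibre at `x` of the Atiyah bundle `At(P) = TP / G`. -/
def At (x : X₀) : Type _ := Quotient (𝒬.orbitRel x)

/-- The class in `At(P)_x` of a tangent vector at a point `a` over `x`. -/
def cls {x : X₀} (a : P) (h : 𝒬.π a = x) (v : TangentSpace 𝓘(ℝ, EP) a) : 𝒬.At x :=
  Quotient.mk (𝒬.orbitRel x) ⟨⟨a, v⟩, h⟩

theorem cls_dR {x : X₀} (a : P) (g : G) (h : 𝒬.π a = x) (h' : 𝒬.π (𝒬.act a g) = x)
    (v : TangentSpace 𝓘(ℝ, EP) a) : 𝒬.cls (𝒬.act a g) h' (𝒬.dR g a v) = 𝒬.cls a h v :=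
  (Quotient.sound (s := 𝒬.orbitRel x) ⟨g, rfl⟩ : 𝒬.cls a h v = _).symm

theorem cls_congr {x : X₀} {a b : P} (hab : a = b) (h : 𝒬.π a = x) (h' : 𝒬.π b = x)
    {v : TangentSpace 𝓘(ℝ, EP) a} {w : TangentSpace 𝓘(ℝ, EP) b} (hvw : (v : EP) = w) :
    𝒬.cls a h v = 𝒬.cls b h' w := by
  subst hab
  have hvw' : v = w := hvw
  subst hvw'
  rfl

theorem cls_injective {x : X₀} (a : P) (h : 𝒬.π a = x) : Function.Injective (𝒬.cls a h) := by
  intro v w hvw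
  obtain ⟨g, hg⟩ : ∃ g : G, (⟨𝒬.act a g, 𝒬.dR g a v⟩ : TangentBundle 𝓘(ℝ, EP) P) = ⟨a, w⟩ :=
    Quotient.exact (s := 𝒬.orbitRel x) hvw
  obtain rfl := 𝒬.free (congrArg (fun u : TangentBundle 𝓘(ℝ, EP) P => u.1) hg)
  have key : ∀ u u' : TangentBundle 𝓘(ℝ, EP) P, u = u' → (u.2 : EP) = u'.2 := by
    rintro u _ rfl; rfl
  exact (𝒬.dR_one a v).symm.trans (key _ _ hg)

theorem cls_surjective {x : X₀} (a : P) (h : 𝒬.π a = x) : Function.Surjective (𝒬.cls a h) := by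
  intro ξ
  induction ξ using Quotient.inductionOn with
  | _ v =>
  obtain ⟨⟨b, w⟩, hb⟩ := v
  obtain ⟨g, rfl⟩ := 𝒬.transitive (hb.trans h.symm)
  exact ⟨𝒬.dR g b w, 𝒬.cls_dR b g hb h w⟩

/-- A chosen point over `x`. -/
noncomputable def basePoint (x : X₀) : P := (𝒬.π_surjective x).choose

theorem π_basePoint (x : X₀) : 𝒬.π (𝒬.basePoint x) = x := (𝒬.π_surjective x).choose_spec

/-- The bijection between `At(P)_x` and the tangent space of `P` at the chosen point over `x`. -/
noncomputable def equivAt (x : X₀) : 𝒬.At x ≃ TangentSpace 𝓘(ℝ, EP) (𝒬.basePoint x) :=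
  (Equiv.ofBijective _ ⟨𝒬.cls_injective _ (𝒬.π_basePoint x), 𝒬.cls_surjective _ (𝒬.π_basePoint x)⟩).symm

/- The vector space structure of `At(P)_x` is the one for which `v ↦ [v]` is linear on `T_a P` for
every `a` over `x`; see `clsₗ`. -/
noncomputable instance (x : X₀) : AddCommGroup (𝒬.At x) := (𝒬.equivAt x).addCommGroup

noncomputable instance (x : X₀) : Module ℝ (𝒬.At x) := (𝒬.equivAt x).module ℝ

/-- The linear bijection `T_a P → At(P)_x`, `v ↦ [v]`, for a point `a` over `x`. -/
noncomputable def clsₗ {x : X₀} (a : P) (h : 𝒬.π a = x) :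
    TangentSpace 𝓘(ℝ, EP) a →ₗ[ℝ] 𝒬.At x := by
  have hg := 𝒬.transitive ((𝒬.π_basePoint x).trans h.symm).symm
  have e : ∀ v, 𝒬.equivAt x (𝒬.cls a h v) = (𝒬.dR hg.choose a v : EP) := fun v => by
    refine ((𝒬.equivAt x).eq_symm_apply.mp ?_)
    have h1 := 𝒬.cls_dR a hg.choose h ((𝒬.π_act _ _).trans h) v
    exact h1.symm.trans (𝒬.cls_congr hg.choose_spec _ _ rfl)
  exact
    { toFun := 𝒬.cls a h
      map_add' := fun v w => by
        apply (𝒬.equivAt x).injective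
        have h1 : 𝒬.equivAt x (𝒬.cls a h v + 𝒬.cls a h w) =
          𝒬.equivAt x (𝒬.cls a h v) + 𝒬.equivAt x (𝒬.cls a h w) := (𝒬.equivAt x).apply_symm_apply _
        have h2 : (𝒬.dR hg.choose a (v + w) : EP) =
          (𝒬.dR hg.choose a v : EP) + (𝒬.dR hg.choose a w : EP) := map_add _ _ _
        have h3 : (𝒬.equivAt x (𝒬.cls a h v) + 𝒬.equivAt x (𝒬.cls a h w) : EP) =
          (𝒬.dR hg.choose a v : EP) + (𝒬.dR hg.choose a w : EP) :=
          congrArg₂ (fun u u' : EP => u + u') (e v) (e w)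
        exact ((e _).trans h2).trans (h3.symm.trans h1.symm)
      map_smul' := fun c v => by
        apply (𝒬.equivAt x).injective
        have h1 : 𝒬.equivAt x (c • 𝒬.cls a h v) = c • 𝒬.equivAt x (𝒬.cls a h v) :=
          (𝒬.equivAt x).apply_symm_apply _
        have h2 : (𝒬.dR hg.choose a (c • v) : EP) = c • (𝒬.dR hg.choose a v : EP) := map_smul _ _ _
        have h3 : (c • 𝒬.equivAt x (𝒬.cls a h v) : EP) = c • (𝒬.dR hg.choose a v : EP) :=
          congrArg (fun u : EP => c • u) (e v)
        exact ((e _).trans h2).trans (h3.symm.trans h1.symm) }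

@[simp] theorem clsₗ_apply {x : X₀} (a : P) (h : 𝒬.π a = x) (v : TangentSpace 𝓘(ℝ, EP) a) :
    𝒬.clsₗ a h v = 𝒬.cls a h v := rfl

/-- The linear map on `At(P)_x` induced by a `G`-invariant family of linear maps on the tangent
spaces at the points over `x`. -/
noncomputable def lift {x : X₀} {W : Type*} [AddCommGroup W] [Module ℝ W]
    (L : ∀ a, 𝒬.π a = x → TangentSpace 𝓘(ℝ, EP) a →ₗ[ℝ] W)
    (hL : ∀ a h g h' v, L (𝒬.act a g) h' (𝒬.dR g a v) = L a h v) : 𝒬.At x →ₗ[ℝ] W := by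
  let F : 𝒬.At x → W := Quotient.lift (s := 𝒬.orbitRel x) (fun v => L v.1.1 v.2 v.1.2) (by
    rintro ⟨v, hv⟩ ⟨w, hw⟩ ⟨g, hg⟩
    subst hg
    exact (hL v.1 hv g hw v.2).symm)
  have hF : ∀ a h v, F (𝒬.cls a h v) = L a h v := fun a h v => rfl
  exact
    { toFun := F
      map_add' := fun ξ η => by
        obtain ⟨v, rfl⟩ := 𝒬.cls_surjective _ (𝒬.π_basePoint x) ξ
        obtain ⟨w, rfl⟩ := 𝒬.cls_surjective _ (𝒬.π_basePoint x) η
        rw [← clsₗ_apply, ← clsₗ_apply, ← map_add, clsₗ_apply, clsₗ_apply, clsₗ_apply, hF, hF, hF, map_add]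
      map_smul' := fun c ξ => by
        obtain ⟨v, rfl⟩ := 𝒬.cls_surjective _ (𝒬.π_basePoint x) ξ
        rw [← clsₗ_apply, ← map_smul, clsₗ_apply, clsₗ_apply, hF, hF, map_smul]; rfl }

@[simp] theorem lift_cls {x : X₀} {W : Type*} [AddCommGroup W] [Module ℝ W]
    (L : ∀ a, 𝒬.π a = x → TangentSpace 𝓘(ℝ, EP) a →ₗ[ℝ] W)
    (hL : ∀ a h g h' v, L (𝒬.act a g) h' (𝒬.dR g a v) = L a h v)
    (a : P) (h : 𝒬.π a = x) (v : TangentSpace 𝓘(ℝ, EP) a) : 𝒬.lift L hL (𝒬.cls a h v) = L a h v := rfl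

/-- The anchor `At(P)_x → T_x X₀` induced by the differential of `π`. -/
noncomputable def anchor (x : X₀) : 𝒬.At x →ₗ[ℝ] TangentSpace 𝓘(ℝ, E₀) x :=
  𝒬.lift (fun a h => 𝒬.dπ a x h) fun a h g h' v => 𝒬.dπ_dR g a x h h' v

/-- The fibre at `x` of the adjoint bundle `ad(P) = ker(dπ) / G ⊆ At(P)`. -/
noncomputable abbrev Ad (x : X₀) : Submodule ℝ (𝒬.At x) := LinearMap.ker (𝒬.anchor x)

/-- The adjoint action of `g⁻¹` on `𝔤`, the differential of `h ↦ g⁻¹ h g` at `1`. -/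
noncomputable def _root_.adInv (EG : Type*) [NormedAddCommGroup EG] [NormedSpace ℝ EG]
    {G : Type*} [TopologicalSpace G] [ChartedSpace EG G] [Group G]
    (g : G) (A : GroupLieAlgebra 𝓘(ℝ, EG) G) : GroupLieAlgebra 𝓘(ℝ, EG) G :=
  (mfderiv 𝓘(ℝ, EG) 𝓘(ℝ, EG) (fun h : G => g⁻¹ * h * g) 1 A :)

/-- A connection `1`-form on the principal bundle: a smooth `𝔤`-valued `1`-form which is the
identity of `𝔤` on fundamental vectors and `Ad`-equivariant. -/
structure ConnectionForm where
  /-- the form -/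
  toFun : ∀ a : P, TangentSpace 𝓘(ℝ, EP) a →ₗ[ℝ] GroupLieAlgebra 𝓘(ℝ, EG) G
  smooth : ContMDiff (M' := EG) 𝓘(ℝ, EP).tangent 𝓘(ℝ, EG) ∞
    (fun v : TangentBundle 𝓘(ℝ, EP) P => (toFun v.1 v.2))
  fundamental : ∀ a A, toFun a (𝒬.ζ a A) = A
  equivariant : ∀ a g v, toFun (𝒬.act a g) (𝒬.dR g a v) = adInv EG g (toFun a v)

theorem ζ_adInv (a : P) (g : G) (A : GroupLieAlgebra 𝓘(ℝ, EG) G) :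
    (𝒬.ζ (𝒬.act a g) (adInv EG g A) : EP) = 𝒬.dR g a (𝒬.ζ a A) := by
  have hc : ContMDiff 𝓘(ℝ, EG) 𝓘(ℝ, EG) ∞ (fun h : G => g⁻¹ * h * g) :=
    (contMDiff_const.mul contMDiff_id).mul contMDiff_const
  have e : 𝒬.act (𝒬.act a g) ∘ (fun h : G => g⁻¹ * h * g) = 𝒬.R g ∘ 𝒬.act a := by
    funext h
    simp only [Function.comp_apply, R, ← 𝒬.act_mul]
    congr 1
    group
  have h1 := mfderiv_comp_apply (1 : G)
    ((𝒬.orbit_smooth (𝒬.act a g)).mdifferentiable FiberProduct.ne_zero_aux (g⁻¹ * 1 * g))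
    (hc.mdifferentiable FiberProduct.ne_zero_aux 1) A
  have h2 := mfderiv_comp_apply (1 : G)
    ((𝒬.R_smooth g).mdifferentiable FiberProduct.ne_zero_aux (𝒬.act a 1))
    ((𝒬.orbit_smooth a).mdifferentiable FiberProduct.ne_zero_aux 1) A
  rw [e] at h1
  have k1 : ∀ h : G, h = 1 → ∀ v : EG, (mfderiv 𝓘(ℝ, EG) 𝓘(ℝ, EP) (𝒬.act (𝒬.act a g)) h v : EP) =
      mfderiv 𝓘(ℝ, EG) 𝓘(ℝ, EP) (𝒬.act (𝒬.act a g)) 1 v := by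
    rintro h rfl v; rfl
  have k2 : ∀ b : P, b = a → ∀ v : EP, (mfderiv 𝓘(ℝ, EP) 𝓘(ℝ, EP) (𝒬.R g) b v : EP) =
      mfderiv 𝓘(ℝ, EP) 𝓘(ℝ, EP) (𝒬.R g) a v := by
    rintro b rfl v; rfl
  exact (k1 (g⁻¹ * 1 * g) (by group) _).symm.trans (h1.symm.trans (h2.trans (k2 _ (𝒬.act_one a) _)))

/-- The homomorphism `At(P) → ad(P)` corresponding to a connection form `α`: it sends `[v]`, for
`v` in `T_a P`, to the class of the vertical vector at `a` generated by `α(v)`. -/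
noncomputable def ConnectionForm.D {𝒬 : PrincipalBundle EP E₀ EG P X₀ G} (α : 𝒬.ConnectionForm) (x : X₀) :
    𝒬.At x →ₗ[ℝ] 𝒬.Ad x :=
  𝒬.lift (fun a h => (𝒬.clsₗ a h ∘ₗ 𝒬.ζ a ∘ₗ α.toFun a).codRestrict (𝒬.Ad x)
      fun v => 𝒬.dπ_ζ a x h (α.toFun a v)) (by
    intro a h g h' v
    apply Subtype.ext
    show 𝒬.cls (𝒬.act a g) h' (𝒬.ζ (𝒬.act a g) (α.toFun (𝒬.act a g) (𝒬.dR g a v))) =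
      𝒬.cls a h (𝒬.ζ a (α.toFun a v))
    rw [α.equivariant, ← 𝒬.cls_dR a g h h']
    exact 𝒬.cls_congr rfl _ _ (𝒬.ζ_adInv a g _))

end PrincipalBundle

namespace LieGroupoid

theorem m_congr (𝒳 : LieGroupoid E₁ E₀ X₁ X₀) {a a' b b' : X₁} (h₁ : a = a') (h₂ : b = b')
    (h : 𝒳.s a = 𝒳.t b) (h' : 𝒳.s a' = 𝒳.t b') : 𝒳.m (.mk a b h) = 𝒳.m (.mk a' b' h') := by
  subst h₁; subst h₂; rfl

/-- A right principal `G`-bundle over a Lie groupoid `𝒳`: a principal `G`-bundle `π : P → X₀`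
with a left action `μ (γ, a) = γ a`, for `s γ = π a`, which commutes with the action of `G`. The
domain of `μ` is `s^* P`. -/
structure PrincipalBundle (𝒳 : LieGroupoid E₁ E₀ X₁ X₀) (EP EG P G : Type*)
    [NormedAddCommGroup EP] [NormedSpace ℝ EP] [NormedAddCommGroup EG] [NormedSpace ℝ EG]
    [TopologicalSpace P] [ChartedSpace EP P]
    [TopologicalSpace G] [ChartedSpace EG G] [Group G] extends
    _root_.PrincipalBundle EP E₀ EG P X₀ G where
  /-- action of the groupoid -/
  μ : FiberProduct 𝒳.s_submersion π_smooth → P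
  μ_smooth : ContMDiff 𝓘(ℝ, 𝒳.s_submersion.complement × EP) 𝓘(ℝ, EP) ∞ μ
  π_μ : ∀ q, π (μ q) = 𝒳.t q.fst
  μ_e : ∀ a, μ (.mk (𝒳.e (π a)) a (𝒳.s_e _)) = a
  μ_μ : ∀ (γ' γ : X₁) (a : P) (h' : 𝒳.s γ' = 𝒳.t γ) (h : 𝒳.s γ = π a),
    μ (.mk γ' (μ (.mk γ a h)) (h'.trans (π_μ (.mk γ a h)).symm)) =
      μ (.mk (𝒳.m (.mk γ' γ h')) a ((𝒳.s_m (.mk γ' γ h')).trans h))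
  μ_act : ∀ (γ : X₁) (a : P) (g : G) (h : 𝒳.s γ = π a),
    act (μ (.mk γ a h)) g = μ (.mk γ (act a g) (h.trans (π_act a g).symm))

namespace PrincipalBundle

variable {𝒳 : LieGroupoid E₁ E₀ X₁ X₀} (ℰ : 𝒳.PrincipalBundle EP EG P G)

theorem μ_congr {γ γ' : X₁} {a a' : P} (h₁ : γ = γ') (h₂ : a = a') (h : 𝒳.s γ = ℰ.π a)
    (h' : 𝒳.s γ' = ℰ.π a') : ℰ.μ (.mk γ a h) = ℰ.μ (.mk γ' a' h') := by
  subst h₁; subst h₂; rfl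

/-- The manifold `s^* P` of pairs `(γ, a)` with `s γ = π a`. -/
abbrev SourcePullback : Type _ := FiberProduct 𝒳.s_submersion ℰ.π_smooth

theorem snd_submersion : IsSubmersion 𝓘(ℝ, 𝒳.s_submersion.complement × EP) 𝓘(ℝ, EP) ∞
    (FiberProduct.snd : ℰ.SourcePullback → P) := by
  refine IsSubmersionOfComplement.isSubmersion (F := 𝒳.s_submersion.complement) fun q => ?_
  refine IsSubmersionAtOfComplement.mk_of_charts
    (ContinuousLinearEquiv.prodComm ℝ 𝒳.s_submersion.complement EP)
    (chartAt _ q) (chartAt EP q.snd) (mem_chart_source _ q) (mem_chart_source EP q.snd)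
    (IsManifold.chart_mem_maximalAtlas q) (IsManifold.chart_mem_maximalAtlas q.snd)
    (fun p hp => hp.2) ?_
  intro z hz
  have hz' : z ∈ (FiberProduct.chart q).target := by
    have h : z ∈ (chartAt (𝒳.s_submersion.complement × EP) q).target := by simpa using hz
    exact h
  show chartAt EP q.snd ((FiberProduct.chart q).symm z).snd = z.2
  rw [FiberProduct.snd_chart_symm q hz']
  exact (chartAt EP q.snd).right_inv hz'.1.1

/-- The Lie groupoid `[s^* P ⇉ P]`. -/
noncomputable def actionGroupoid :
    LieGroupoid (𝒳.s_submersion.complement × EP) EP ℰ.SourcePullback P where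
  s := FiberProduct.snd
  t := ℰ.μ
  s_submersion := ℰ.snd_submersion
  t_smooth := ℰ.μ_smooth
  m c := .mk (𝒳.m (.mk c.fst.fst c.snd.fst
    (c.fst.condition.trans ((congrArg ℰ.π c.condition).trans (ℰ.π_μ c.snd))))) c.snd.snd
    ((𝒳.s_m _).trans c.snd.condition)
  m_smooth := FiberProduct.contMDiff_mk
    (𝒳.m_smooth.comp (FiberProduct.contMDiff_mk
      (FiberProduct.contMDiff_fst.comp FiberProduct.contMDiff_fst)
      (FiberProduct.contMDiff_fst.comp FiberProduct.contMDiff_snd) _))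
    (FiberProduct.contMDiff_snd.comp FiberProduct.contMDiff_snd) _
  e a := .mk (𝒳.e (ℰ.π a)) a (𝒳.s_e _)
  e_smooth := FiberProduct.contMDiff_mk (𝒳.e_smooth.comp ℰ.π_smooth) contMDiff_id _
  i q := .mk (𝒳.i q.fst) (ℰ.μ q) ((𝒳.s_i _).trans (ℰ.π_μ q).symm)
  i_smooth := FiberProduct.contMDiff_mk (𝒳.i_smooth.comp FiberProduct.contMDiff_fst) ℰ.μ_smooth _
  s_m _ := rfl
  t_m c := by
    obtain ⟨⟨⟨⟨γ', a'⟩, h'⟩, ⟨⟨γ, a⟩, h⟩⟩, hc⟩ := c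
    obtain rfl : a' = ℰ.μ (.mk γ a h) := hc
    exact (ℰ.μ_μ γ' γ a (Eq.trans h' (ℰ.π_μ (.mk γ a h))) h).symm
  s_e _ := rfl
  t_e := ℰ.μ_e
  s_i _ := rfl
  t_i q := by
    obtain ⟨⟨γ, a⟩, h⟩ := q
    refine (ℰ.μ_μ (𝒳.i γ) γ a (𝒳.s_i γ) h).trans ?_
    exact (ℰ.μ_congr ((𝒳.i_m γ).trans (congrArg 𝒳.e h)) rfl _ _).trans (ℰ.μ_e a)
  m_assoc a b c _ _ := FiberProduct.ext (𝒳.m_assoc a.fst b.fst c.fst _ _) rfl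
  e_m q := FiberProduct.ext
    ((𝒳.m_congr (congrArg 𝒳.e (ℰ.π_μ q)) rfl _ _).trans (𝒳.e_m q.fst)) rfl
  m_e q := FiberProduct.ext
    ((𝒳.m_congr rfl (congrArg 𝒳.e q.condition.symm) _ _).trans (𝒳.m_e q.fst)) rfl
  i_m q := FiberProduct.ext ((𝒳.i_m q.fst).trans (congrArg 𝒳.e q.condition)) rfl
  m_i q := FiberProduct.ext ((𝒳.m_i q.fst).trans (congrArg 𝒳.e (ℰ.π_μ q).symm)) rfl

/-- The pullback `(d pr₁)⁻¹ H` of `H` to `s^* P`. -/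
noncomputable def pullback (ℋ : 𝒳.SourceComplement) : ℰ.actionGroupoid.SourceComplement where
  H q := (ℋ.H q.fst).comap
    (mfderiv 𝓘(ℝ, 𝒳.s_submersion.complement × EP) 𝓘(ℝ, E₁) FiberProduct.fst q).toLinearMap
  isCompl q := by
    constructor
    · rw [Submodule.disjoint_def]
      intro z hz hz'
      have h2 : mfderiv 𝓘(ℝ, 𝒳.s_submersion.complement × EP) 𝓘(ℝ, EP) FiberProduct.snd q z = 0 := hz'
      refine FiberProduct.mfderiv_injective q ?_ (h2.trans (map_zero _).symm)
      refine Eq.trans ?_ (map_zero _).symm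
      refine (Submodule.disjoint_def.mp (ℋ.isCompl q.fst).disjoint) _ hz ?_
      refine (FiberProduct.condition_mfderiv q z).trans ?_
      exact (congrArg _ h2).trans (map_zero _)
    · rw [codisjoint_iff, Submodule.eq_top_iff']
      intro z
      obtain ⟨h, hh, k, hk, hhk⟩ := Submodule.mem_sup.mp
        ((ℋ.isCompl q.fst).sup_eq_top ▸ Submodule.mem_top :
          mfderiv 𝓘(ℝ, 𝒳.s_submersion.complement × EP) 𝓘(ℝ, E₁) FiberProduct.fst q z ∈
            ℋ.H q.fst ⊔ _)
      have hk' : mfderiv 𝓘(ℝ, E₁) 𝓘(ℝ, E₀) 𝒳.s q.fst k = 0 := hk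
      have hz := FiberProduct.condition_mfderiv q z
      rw [← hhk, map_add, hk', add_zero] at hz
      obtain ⟨z', h1, h2⟩ := FiberProduct.exists_mfderiv_eq q h _ hz
      refine Submodule.mem_sup.mpr ⟨z', ?_, z - z', ?_, add_sub_cancel z' z⟩
      · show mfderiv 𝓘(ℝ, 𝒳.s_submersion.complement × EP) 𝓘(ℝ, E₁) FiberProduct.fst q z' ∈ ℋ.H q.fst
        rw [h1]; exact hh
      · show mfderiv 𝓘(ℝ, 𝒳.s_submersion.complement × EP) 𝓘(ℝ, EP) FiberProduct.snd q (z - z') = 0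
        exact (map_sub _ z z').trans (sub_eq_zero.mpr h2.symm)

variable (ℋ : 𝒳.SourceComplement)

/-- The action of an arrow `γ` on `T_a P`, for `a` over `s γ`: the map `θ` of `[s^* P ⇉ P]`. -/
noncomputable def θP (γ : X₁) (a : P) (h : ℰ.π a = 𝒳.s γ) :
    TangentSpace 𝓘(ℝ, EP) a →ₗ[ℝ] TangentSpace 𝓘(ℝ, EP) (ℰ.μ (.mk γ a h.symm)) :=
  (ℰ.pullback ℋ).θ (.mk γ a h.symm)

/-- Right translation `(γ, a) ↦ (γ, a g)` on `s^* P`. -/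
def pullbackR (g : G) (q : ℰ.SourcePullback) : ℰ.SourcePullback :=
  .mk q.fst (ℰ.act q.snd g) (q.condition.trans (ℰ.π_act _ _).symm)

theorem pullbackR_smooth (g : G) : ContMDiff 𝓘(ℝ, 𝒳.s_submersion.complement × EP)
    𝓘(ℝ, 𝒳.s_submersion.complement × EP) ∞ (ℰ.pullbackR g) :=
  FiberProduct.contMDiff_mk FiberProduct.contMDiff_fst
    ((ℰ.R_smooth g).comp FiberProduct.contMDiff_snd) _

theorem θP_dR (γ : X₁) (a : P) (g : G) (h : ℰ.π a = 𝒳.s γ) (h' : ℰ.π (ℰ.act a g) = 𝒳.s γ)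
    (v : TangentSpace 𝓘(ℝ, EP) a) :
    (ℰ.θP ℋ γ (ℰ.act a g) h' (ℰ.dR g a v) : EP) =
      ℰ.dR g (ℰ.μ (.mk γ a h.symm)) (ℰ.θP ℋ γ a h v) := by
  let q : ℰ.SourcePullback := .mk γ a h.symm
  let z := (ℰ.pullback ℋ).lift q v
  let z' := mfderiv 𝓘(ℝ, 𝒳.s_submersion.complement × EP) 𝓘(ℝ, 𝒳.s_submersion.complement × EP)
    (ℰ.pullbackR g) q z
  have d1 := FiberProduct.contMDiff_fst (hf := 𝒳.s_submersion) (hg := ℰ.π_smooth)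
    |>.mdifferentiable FiberProduct.ne_zero_aux
  have d2 := FiberProduct.contMDiff_snd (hf := 𝒳.s_submersion) (hg := ℰ.π_smooth)
    |>.mdifferentiable FiberProduct.ne_zero_aux
  have dμ := ℰ.μ_smooth.mdifferentiable FiberProduct.ne_zero_aux
  have dR := (ℰ.R_smooth g).mdifferentiable FiberProduct.ne_zero_aux
  have dRp := (ℰ.pullbackR_smooth g).mdifferentiable FiberProduct.ne_zero_aux
  have e1 : mfderiv 𝓘(ℝ, 𝒳.s_submersion.complement × EP) 𝓘(ℝ, E₁) FiberProduct.fst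
      (ℰ.pullbackR g q) z' =
      mfderiv 𝓘(ℝ, 𝒳.s_submersion.complement × EP) 𝓘(ℝ, E₁) FiberProduct.fst q z :=
    (mfderiv_comp_apply q (d1 _) (dRp q) z).symm
  have e2 : mfderiv 𝓘(ℝ, 𝒳.s_submersion.complement × EP) 𝓘(ℝ, EP) FiberProduct.snd
      (ℰ.pullbackR g q) z' = ℰ.dR g a v := by
    have h1 := mfderiv_comp_apply q (d2 _) (dRp q) z
    have h2 := mfderiv_comp_apply q (dR _) (d2 q) z
    exact h1.symm.trans (h2.trans (congrArg _ ((ℰ.pullback ℋ).mfderiv_lift q v)))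
  have hz : z' ∈ (ℰ.pullback ℋ).H (ℰ.pullbackR g q) := by
    show mfderiv 𝓘(ℝ, 𝒳.s_submersion.complement × EP) 𝓘(ℝ, E₁) FiberProduct.fst
      (ℰ.pullbackR g q) z' ∈ ℋ.H γ
    rw [e1]
    exact (ℰ.pullback ℋ).lift_mem q v
  have hl := (ℰ.pullback ℋ).eq_lift hz e2
  have hμ : ℰ.μ ∘ ℰ.pullbackR g = ℰ.R g ∘ ℰ.μ :=
    funext fun q => (ℰ.μ_act q.fst q.snd g q.condition).symm
  have h1 := mfderiv_comp_apply q (dμ _) (dRp q) z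
  have h2 := mfderiv_comp_apply q (dR _) (dμ q) z
  rw [hμ] at h1
  have h3 : (ℰ.θP ℋ γ (ℰ.act a g) h' (ℰ.dR g a v) : EP) =
      mfderiv 𝓘(ℝ, 𝒳.s_submersion.complement × EP) 𝓘(ℝ, EP) ℰ.μ (ℰ.pullbackR g q) z' :=
    congrArg _ hl.symm
  exact h3.trans (h1.symm.trans h2)

theorem dπ_θP (γ : X₁) (a : P) (h : ℰ.π a = 𝒳.s γ) (v : TangentSpace 𝓘(ℝ, EP) a) :
    ℰ.dπ (ℰ.μ (.mk γ a h.symm)) (𝒳.t γ) (ℰ.π_μ _) (ℰ.θP ℋ γ a h v) =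
      ℋ.θ γ (ℰ.dπ a (𝒳.s γ) h v) := by
  let q : ℰ.SourcePullback := .mk γ a h.symm
  let z := (ℰ.pullback ℋ).lift q v
  have d1 := FiberProduct.contMDiff_fst (hf := 𝒳.s_submersion) (hg := ℰ.π_smooth)
    |>.mdifferentiable FiberProduct.ne_zero_aux
  have dμ := ℰ.μ_smooth.mdifferentiable FiberProduct.ne_zero_aux
  have dπ := ℰ.π_smooth.mdifferentiable FiberProduct.ne_zero_aux
  have dt := 𝒳.t_smooth.mdifferentiable FiberProduct.ne_zero_aux
  have hl := ℋ.eq_lift ((ℰ.pullback ℋ).lift_mem q v)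
    ((FiberProduct.condition_mfderiv q z).trans
      (congrArg _ ((ℰ.pullback ℋ).mfderiv_lift q v)))
  have hμ : ℰ.π ∘ ℰ.μ = 𝒳.t ∘ FiberProduct.fst := funext fun q => ℰ.π_μ q
  have h1 := mfderiv_comp_apply q (dπ _) (dμ q) z
  have h2 := mfderiv_comp_apply q (dt _) (d1 q) z
  rw [hμ] at h1
  exact h1.symm.trans (h2.trans (congrArg _ hl))

/-- The map `At(P)_{s γ} → At(P)_{t γ}` given by an arrow `γ`. -/
noncomputable def ρAt (γ : X₁) : ℰ.At (𝒳.s γ) →ₗ[ℝ] ℰ.At (𝒳.t γ) :=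
  ℰ.lift (fun a h => ℰ.clsₗ (ℰ.μ (.mk γ a h.symm)) (ℰ.π_μ _) ∘ₗ ℰ.θP ℋ γ a h) (by
    intro a h g h' v
    have h1 := ℰ.cls_dR (ℰ.μ (.mk γ a h.symm)) g (ℰ.π_μ _) ((ℰ.π_act _ _).trans (ℰ.π_μ _))
      (ℰ.θP ℋ γ a h v)
    exact (ℰ.cls_congr (ℰ.μ_act γ a g h.symm).symm _ _ (ℰ.θP_dR ℋ γ a g h h' v)).trans h1)

theorem anchor_ρAt (γ : X₁) (ξ : ℰ.At (𝒳.s γ)) :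
    ℰ.anchor (𝒳.t γ) (ℰ.ρAt ℋ γ ξ) = ℋ.θ γ (ℰ.anchor (𝒳.s γ) ξ) := by
  obtain ⟨v, rfl⟩ := ℰ.cls_surjective _ (ℰ.π_basePoint _) ξ
  exact ℰ.dπ_θP ℋ γ _ (ℰ.π_basePoint _) v

/-- The map `ad(P)_{s γ} → ad(P)_{t γ}` given by an arrow `γ`, the restriction of the one on
`At(P)`. -/
noncomputable def ρAd (γ : X₁) : ℰ.Ad (𝒳.s γ) →ₗ[ℝ] ℰ.Ad (𝒳.t γ) :=
  (ℰ.ρAt ℋ γ).restrict fun ξ hξ => by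
    have h : ℰ.anchor (𝒳.s γ) ξ = 0 := hξ
    exact (ℰ.anchor_ρAt ℋ γ ξ).trans ((congrArg _ h).trans (map_zero _))

end PrincipalBundle
end LieGroupoid

namespace LieGroupoid

/-- The smooth structure of a bundle `V` over `X₀`, recorded through the smooth maps from the
spaces `ℝⁿ` to its total space. -/
abbrev Plots (V : X₀ → Type*) : Type _ :=
  ∀ n : ℕ, (EuclideanSpace ℝ (Fin n) → (x : X₀) × V x) → Prop

/-- A vector bundle over the Lie groupoid `𝒳`: the linear maps `ρ γ : V (s γ) → V (t γ)` form a
smooth action of `𝒳` on the vector bundle `V` over `X₀`. -/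
structure IsVectorBundle (𝒳 : LieGroupoid E₁ E₀ X₁ X₀) (V : X₀ → Type*)
    [∀ x, AddCommGroup (V x)] [∀ x, Module ℝ (V x)] (S : Plots V)
    (ρ : ∀ γ : X₁, V (𝒳.s γ) →ₗ[ℝ] V (𝒳.t γ)) : Prop where
  unit : ∀ (x : X₀) (ξ : V (𝒳.s (𝒳.e x))),
    (⟨𝒳.t (𝒳.e x), ρ (𝒳.e x) ξ⟩ : (x : X₀) × V x) = ⟨𝒳.s (𝒳.e x), ξ⟩
  mult : ∀ (γ' γ : X₁) (h : 𝒳.s γ' = 𝒳.t γ) (ξ : V (𝒳.s γ)) (η : V (𝒳.s γ'))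
    (χ : V (𝒳.s (𝒳.m (.mk γ' γ h)))),
    (⟨𝒳.s γ', η⟩ : (x : X₀) × V x) = ⟨𝒳.t γ, ρ γ ξ⟩ →
    (⟨𝒳.s (𝒳.m (.mk γ' γ h)), χ⟩ : (x : X₀) × V x) = ⟨𝒳.s γ, ξ⟩ →
    (⟨𝒳.t (𝒳.m (.mk γ' γ h)), ρ _ χ⟩ : (x : X₀) × V x) = ⟨𝒳.t γ', ρ γ' η⟩
  smooth : ∀ (n : ℕ) (c : EuclideanSpace ℝ (Fin n) → X₁) (ξ : ∀ y, V (𝒳.s (c y))),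
    ContMDiff 𝓘(ℝ, EuclideanSpace ℝ (Fin n)) 𝓘(ℝ, E₁) ∞ c →
    S n (fun y => ⟨𝒳.s (c y), ξ y⟩) → S n (fun y => ⟨𝒳.t (c y), ρ (c y) (ξ y)⟩)

/-- The smooth structure of the tangent bundle. -/
def tangentPlots : Plots (fun x : X₀ => TangentSpace 𝓘(ℝ, E₀) x) := fun n p =>
  ContMDiff 𝓘(ℝ, EuclideanSpace ℝ (Fin n)) 𝓘(ℝ, E₀).tangent ∞
    (fun y => (⟨(p y).1, (p y).2⟩ : TangentBundle 𝓘(ℝ, E₀) X₀))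

end LieGroupoid

namespace PrincipalBundle

variable (𝒬 : PrincipalBundle EP E₀ EG P X₀ G)

/-- The smooth structure of `At(P) = TP / G`: since `TP → TP / G` is a surjective submersion, a map
to the quotient is smooth if and only if it locally lifts to a smooth map to `TP`. -/
def atPlots : LieGroupoid.Plots 𝒬.At := fun n p =>
  ∀ y₀, ∃ U : Set (EuclideanSpace ℝ (Fin n)), IsOpen U ∧ y₀ ∈ U ∧
    ∃ r : EuclideanSpace ℝ (Fin n) → TangentBundle 𝓘(ℝ, EP) P,
      ContMDiffOn 𝓘(ℝ, EuclideanSpace ℝ (Fin n)) 𝓘(ℝ, EP).tangent ∞ r U ∧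
      ∀ y ∈ U, p y = ⟨𝒬.π (r y).1, 𝒬.cls (r y).1 rfl (r y).2⟩

/-- The smooth structure of the subbundle `ad(P)` of `At(P)`. -/
def adPlots : LieGroupoid.Plots (fun x => 𝒬.Ad x) := fun n p =>
  𝒬.atPlots n (fun y => ⟨(p y).1, ((p y).2 : 𝒬.At (p y).1)⟩)

end PrincipalBundle

namespace LieGroupoid.PrincipalBundle

variable {𝒳 : LieGroupoid E₁ E₀ X₁ X₀} (ℰ : 𝒳.PrincipalBundle EP EG P G)

/-- `D : At(P) → ad(P)` is a smooth splitting of the Atiyah sequence `0 → ad(P) → At(P) → TX₀ → 0`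
which commutes with the actions of the arrows of `𝒳`. -/
structure IsEquivariantSplitting (ℋ : 𝒳.Connection) (D : ∀ x, ℰ.At x →ₗ[ℝ] ℰ.Ad x) : Prop where
  smooth : ∀ n p, ℰ.atPlots n p → ℰ.adPlots n (fun y => ⟨(p y).1, D (p y).1 (p y).2⟩)
  retraction : ∀ (x : X₀) (ξ : ℰ.Ad x), D x (ξ : ℰ.At x) = ξ
  equivariant : ∀ (γ : X₁) (ξ : ℰ.At (𝒳.s γ)),
    D (𝒳.t γ) (ℰ.ρAt ℋ.toSourceComplement γ ξ) =
      ℰ.ρAd ℋ.toSourceComplement γ (D (𝒳.s γ) ξ)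

/-- `D` is a connection on the principal bundle over `𝒳`: `TX₀`, `At(P)` and `ad(P)` are vector
bundles over `𝒳`, and `D` splits the Atiyah sequence of vector bundles over `𝒳`. -/
structure IsConnection (ℋ : 𝒳.Connection) (D : ∀ x, ℰ.At x →ₗ[ℝ] ℰ.Ad x) : Prop where
  tangent : 𝒳.IsVectorBundle (fun x => TangentSpace 𝓘(ℝ, E₀) x) tangentPlots ℋ.θ
  atiyah : 𝒳.IsVectorBundle ℰ.At ℰ.atPlots (ℰ.ρAt ℋ.toSourceComplement)
  adjoint : 𝒳.IsVectorBundle (fun x => ℰ.Ad x) ℰ.adPlots (ℰ.ρAd ℋ.toSourceComplement)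
  splitting : ℰ.IsEquivariantSplitting ℋ D

end LieGroupoid.PrincipalBundle

end Groupoid

/-! Write `ω` for the connection form `α.toFun`, and `θ̃` for the map `θ` of the action groupoid
`[s^* P ⇉ P]`. A tangent vector `v` of `P` at `a` is determined by the pair `(dπ v, ω v)`: vertical
vectors are fundamental, and `ω` recovers `A` from `ζ_a A` (`exists_ζ_eq`,
`ConnectionForm.eq_of_mfderiv_eq`). The map `θ̃` covers `θ` on `TX₀`, and it sends `ζ_a A` to `ζ_{γ
a} A`, because the groupoid action commutes with `G` and a curve in `s^* P` with constant arrow is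
horizontal (`pullback_θ_ζ`).

Conditions 2 and 3. Since `P_H` is `ds` followed by the horizontal lift, `ω` is a form on the
groupoid exactly when `ω (θ̃ v) = ω v` for all `v` (`isForm_iff`). On a class `[v]` the two sides of
the equivariance of `D` are the classes at `γ a` of the fundamental vectors generated by `ω (θ̃ v)`
and `ω v`; these agree exactly when the generators do (`D_equivariant_iff`). The retraction property
and the smoothness of `D` hold for every connection form.

Conditions 1 and 3. A connection contains an equivariant splitting, so 3 follows from 1. Conversely,
3 must make `TX₀`, `At(P)` and `ad(P)` vector bundles over the groupoid. The delicate axiom is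
multiplicativity on `At(P)`. The product of two horizontal vectors of `X₁` has the same `ds` and
`dt` as a horizontal vector, but may differ from it by an element of `ker ds ∩ ker dt`, which can
act on `P` by a vertical vector. The invariant form removes this ambiguity: the two candidates have
the same `dπ` by multiplicativity of `θ` and the same `ω` by invariance, hence coincide
(`pullback_θ_mult`). The unit axiom comes from `H = de(TX₀)` along the units, and `ad(P)` inherits
everything from `At(P)`.

Smoothness of the actions reduces to smoothness of the horizontal lift: lift locally through a
submersion chart of `s`, then apply the smooth projection `P_H`. -/

section Groupoid

variable {E₁ : Type*} [NormedAddCommGroup E₁] [NormedSpace ℝ E₁]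
  {E₀ : Type*} [NormedAddCommGroup E₀] [NormedSpace ℝ E₀]
  {EP : Type*} [NormedAddCommGroup EP] [NormedSpace ℝ EP]
  {EG : Type*} [NormedAddCommGroup EG] [NormedSpace ℝ EG]
  {X₁ : Type*} [TopologicalSpace X₁] [ChartedSpace E₁ X₁] [IsManifold 𝓘(ℝ, E₁) ∞ X₁]
  {X₀ : Type*} [TopologicalSpace X₀] [ChartedSpace E₀ X₀] [IsManifold 𝓘(ℝ, E₀) ∞ X₀]
  {P : Type*} [TopologicalSpace P] [ChartedSpace EP P] [IsManifold 𝓘(ℝ, EP) ∞ P]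
  {G : Type*} [TopologicalSpace G] [ChartedSpace EG G] [Group G] [LieGroup 𝓘(ℝ, EG) ∞ G]

/-- The differential of a map does not depend on the expression of the base point. -/
theorem mfderiv_apply_congr_point (f : P → X₀) {a b : P} (h : a = b) (v : EP) :
    (mfderiv 𝓘(ℝ, EP) 𝓘(ℝ, E₀) f a v : E₀) = mfderiv 𝓘(ℝ, EP) 𝓘(ℝ, E₀) f b v := by
  subst h; rfl

/-! ### Groupoid forms and the maps `θ` -/

namespace LieGroupoid

variable {𝒳 : LieGroupoid E₁ E₀ X₁ X₀}

theorem SourceComplement.θ_congr (ℋ : 𝒳.SourceComplement) {γ γ' : X₁} (h : γ = γ') (v : E₀) :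
    (ℋ.θ γ v : E₀) = ℋ.θ γ' v := by
  subst h; rfl

/-- `P_H z` differs from `z` by an element of `ker ds`, so both have the same `ds`, and a vector of
`H` is determined by its `ds`. This turns statements about `P_H` into statements about `θ`. -/
theorem SourceComplement.proj_eq_lift (ℋ : 𝒳.SourceComplement) (γ : X₁)
    (z : TangentSpace 𝓘(ℝ, E₁) γ) :
    ℋ.proj γ z = ℋ.lift γ (mfderiv 𝓘(ℝ, E₁) 𝓘(ℝ, E₀) 𝒳.s γ z) := by
  refine ℋ.eq_lift (Submodule.projection_apply_mem _ _) ?_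
  have h : z - ℋ.proj γ z ∈ (mfderiv 𝓘(ℝ, E₁) 𝓘(ℝ, E₀) 𝒳.s γ).ker :=
    Submodule.sub_projection_mem (ℋ.isCompl γ) z
  have h' : mfderiv 𝓘(ℝ, E₁) 𝓘(ℝ, E₀) 𝒳.s γ (z - ℋ.proj γ z) = 0 := h
  rw [map_sub] at h'
  exact (sub_eq_zero.mp h').symm

/-- A form is a form on the Lie groupoid if and only if it is invariant under the maps `θ`. -/
theorem isForm_iff (ℋ : 𝒳.SourceComplement) {W : Type*} [AddCommGroup W] [Module ℝ W]
    (φ : ∀ x : X₀, TangentSpace 𝓘(ℝ, E₀) x →ₗ[ℝ] W) :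
    𝒳.IsForm ℋ φ ↔ ∀ γ v, φ (𝒳.t γ) (ℋ.θ γ v) = φ (𝒳.s γ) v := by
  constructor
  · intro h γ v
    -- `P_H` fixes horizontal lifts, so evaluating there gives `φ v` on the source side and `φ (θ
    -- v)` on the target side.
    have h1 := LinearMap.congr_fun (congrFun h γ) (ℋ.lift γ v)
    have h2 : ℋ.proj γ (ℋ.lift γ v) = ℋ.lift γ v := by
      rw [ℋ.proj_eq_lift, ℋ.mfderiv_lift]
    simp only [SourceComplement.horizontal, LinearMap.comp_apply, h2] at h1
    refine h1.symm.trans ?_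
    exact congrArg _ (ℋ.mfderiv_lift γ v)
  · intro h
    funext γ
    ext z
    simp only [SourceComplement.horizontal, LinearMap.comp_apply]
    rw [ℋ.proj_eq_lift]
    refine Eq.trans (congrArg _ (ℋ.mfderiv_lift γ _)) ?_
    exact (h γ _).symm

/-- Along the units `H` is the image of `de`, and `s ∘ e = id`, so the horizontal lift of `v` is `de
v`; then `t ∘ e = id` returns `v`. -/
theorem Connection.θ_unit (ℋ : 𝒳.Connection) (x : X₀) (v : E₀) :
    (ℋ.θ (𝒳.e x) v : E₀) = v := by
  have hs := 𝒳.s_submersion.contMDiff.mdifferentiable FiberProduct.ne_zero_aux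
  have ht := 𝒳.t_smooth.mdifferentiable FiberProduct.ne_zero_aux
  have he := 𝒳.e_smooth.mdifferentiable FiberProduct.ne_zero_aux
  have h1 := mfderiv_comp_apply x (hs _) (he x) v
  have h2 := mfderiv_comp_apply x (ht _) (he x) v
  have e1 : 𝒳.s ∘ 𝒳.e = id := funext 𝒳.s_e
  have e2 : 𝒳.t ∘ 𝒳.e = id := funext 𝒳.t_e
  rw [e1, mfderiv_id] at h1
  rw [e2, mfderiv_id] at h2
  have h3 := ℋ.eq_lift (γ := 𝒳.e x) (v := v) (ℋ.unit x ▸ ⟨v, rfl⟩) h1.symm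
  exact (congrArg _ h3.symm).trans h2.symm

/-! ### The action of arrows on tangent vectors of `P` -/

namespace PrincipalBundle

variable (ℰ : 𝒳.PrincipalBundle EP EG P G) (ℋ : 𝒳.SourceComplement)

/-- The left side lies in `H` by definition of the pulled-back distribution, and `ds ∘ d pr₁ = dπ ∘
d pr₂` gives its source vector. This describes the component of a lift in `X₁`, from which the
smoothness of lifts to `s^* P` follows. -/
theorem mfderiv_fst_lift (q : ℰ.SourcePullback) (v : EP) :
    (mfderiv 𝓘(ℝ, 𝒳.s_submersion.complement × EP) 𝓘(ℝ, E₁) FiberProduct.fst q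
      ((ℰ.pullback ℋ).lift q v) : E₁) =
      ℋ.lift q.fst (mfderiv 𝓘(ℝ, EP) 𝓘(ℝ, E₀) ℰ.π q.snd v : E₀) :=
  ℋ.eq_lift ((ℰ.pullback ℋ).lift_mem q v)
    ((FiberProduct.condition_mfderiv q _).trans
      (congrArg _ ((ℰ.pullback ℋ).mfderiv_lift q v)))

/-- The map `θ` of `[s^* P ⇉ P]` is computed by the derivative of the action on the curves
through `q` with horizontal first component. -/
theorem pullback_θ_mfderiv {EN : Type*} [NormedAddCommGroup EN] [NormedSpace ℝ EN]
    {N : Type*} [TopologicalSpace N] [ChartedSpace EN N]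
    {u : N → ℰ.SourcePullback} {y : N}
    (hu : MDifferentiableAt 𝓘(ℝ, EN) 𝓘(ℝ, 𝒳.s_submersion.complement × EP) u y)
    (w : TangentSpace 𝓘(ℝ, EN) y)
    (hw : mfderiv 𝓘(ℝ, EN) 𝓘(ℝ, E₁) (fun x => (u x).fst) y w ∈ ℋ.H (u y).fst) :
    ((ℰ.pullback ℋ).θ (u y)
      (mfderiv 𝓘(ℝ, EN) 𝓘(ℝ, EP) (fun x => (u x).snd) y w : EP) : EP) =
      mfderiv 𝓘(ℝ, EN) 𝓘(ℝ, EP) (fun x => ℰ.μ (u x)) y w := by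
  have d1 := FiberProduct.contMDiff_fst (hf := 𝒳.s_submersion) (hg := ℰ.π_smooth)
    |>.mdifferentiable FiberProduct.ne_zero_aux
  have d2 := FiberProduct.contMDiff_snd (hf := 𝒳.s_submersion) (hg := ℰ.π_smooth)
    |>.mdifferentiable FiberProduct.ne_zero_aux
  have dμ := ℰ.μ_smooth.mdifferentiable FiberProduct.ne_zero_aux
  have h1 := mfderiv_comp_apply y (d1 (u y)) hu w
  have h2 := mfderiv_comp_apply y (d2 (u y)) hu w
  have h3 := mfderiv_comp_apply y (dμ (u y)) hu w
  have hz : mfderiv 𝓘(ℝ, EN) 𝓘(ℝ, 𝒳.s_submersion.complement × EP) u y w ∈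
      (ℰ.pullback ℋ).H (u y) := by
    show mfderiv 𝓘(ℝ, 𝒳.s_submersion.complement × EP) 𝓘(ℝ, E₁) FiberProduct.fst (u y) _ ∈
      ℋ.H (u y).fst
    rw [← h1]
    exact hw
  have hl := (ℰ.pullback ℋ).eq_lift hz h2.symm
  exact (congrArg _ hl.symm).trans h3.symm

/-- The arrows act on fundamental vectors by `ζ_a A ↦ ζ_{γ a} A`. -/
theorem pullback_θ_ζ (q : ℰ.SourcePullback) (A : GroupLieAlgebra 𝓘(ℝ, EG) G) :
    ((ℰ.pullback ℋ).θ q (ℰ.ζ q.snd A : EP) : EP) = ℰ.ζ (ℰ.μ q) A := by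
  -- The arrow stays fixed along `g ↦ (γ, a g)`, so the first component has derivative `0`, which
  -- lies in `H` whatever `H` is.
  let u : G → ℰ.SourcePullback := fun g => ℰ.pullbackR g q
  have hu : ContMDiff 𝓘(ℝ, EG) 𝓘(ℝ, 𝒳.s_submersion.complement × EP) ∞ u :=
    FiberProduct.contMDiff_mk contMDiff_const (ℰ.orbit_smooth q.snd) _
  have h0 : u 1 = q := FiberProduct.ext rfl (ℰ.act_one _)
  have h1 : mfderiv 𝓘(ℝ, EG) 𝓘(ℝ, E₁) (fun x => (u x).fst) (1 : G) A ∈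
      ℋ.H (u 1).fst := by
    have : mfderiv 𝓘(ℝ, EG) 𝓘(ℝ, E₁) (fun x => (u x).fst) (1 : G) A = (0 : E₁) := by
      show mfderiv 𝓘(ℝ, EG) 𝓘(ℝ, E₁) (fun _ : G => q.fst) (1 : G) A = (0 : E₁)
      rw [mfderiv_const]; rfl
    rw [this]
    exact (ℋ.H (u 1).fst).zero_mem
  have h2 := ℰ.pullback_θ_mfderiv ℋ (hu.mdifferentiable FiberProduct.ne_zero_aux 1) A h1
  -- Commutation of the two actions: `γ (a g) = (γ a) g` is the orbit map of `γ a`.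
  have h3 : (fun x => ℰ.μ (u x)) = ℰ.act (ℰ.μ q) := funext fun g =>
    (ℰ.μ_act q.fst q.snd g q.condition).symm
  rw [h3] at h2
  exact ((ℰ.pullback ℋ).θ_congr h0 _).symm.trans h2

/-- The unit section `a ↦ (e (π a), a)` has first component `e ∘ π`, whose differential takes values
in the image of `de`, hence in `H`. So it is horizontal, and composing it with `μ` gives the
identity of `P`. -/
theorem pullback_θ_unit (ℋ : 𝒳.Connection) (a : P) (v : EP) :
    ((ℰ.pullback ℋ.toSourceComplement).θ (ℰ.actionGroupoid.e a) v : EP) = v := by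
  have h1 : mfderiv 𝓘(ℝ, EP) 𝓘(ℝ, E₁) (fun x => (ℰ.actionGroupoid.e x).fst) a v ∈
      ℋ.H (ℰ.actionGroupoid.e a).fst := by
    have h := mfderiv_comp_apply a (𝒳.e_smooth.mdifferentiable FiberProduct.ne_zero_aux _)
      (ℰ.π_smooth.mdifferentiable FiberProduct.ne_zero_aux a) v
    have h' : 𝒳.e ∘ ℰ.π = fun x => (ℰ.actionGroupoid.e x).fst := rfl
    rw [h'] at h
    rw [h]
    show _ ∈ ℋ.H (𝒳.e (ℰ.π a))
    rw [← ℋ.unit]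
    exact ⟨_, rfl⟩
  have h2 := ℰ.pullback_θ_mfderiv ℋ.toSourceComplement
    (ℰ.actionGroupoid.e_smooth.mdifferentiable FiberProduct.ne_zero_aux a) v h1
  have e1 : (fun x => ℰ.μ (ℰ.actionGroupoid.e x)) = id := funext ℰ.μ_e
  have e2 : (fun x => (ℰ.actionGroupoid.e x).snd) = id := rfl
  rw [e1, e2, mfderiv_id] at h2
  exact h2

theorem mfderiv_π_pullback_θ (q : ℰ.SourcePullback) (v : EP) :
    (mfderiv 𝓘(ℝ, EP) 𝓘(ℝ, E₀) ℰ.π (ℰ.μ q) ((ℰ.pullback ℋ).θ q v) : E₀) =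
      ℋ.θ q.fst (mfderiv 𝓘(ℝ, EP) 𝓘(ℝ, E₀) ℰ.π q.snd v : E₀) :=
  ℰ.dπ_θP ℋ q.fst q.snd q.condition.symm v

end PrincipalBundle
end LieGroupoid

/-! ### Vertical vectors and the connection form -/

namespace PrincipalBundle

variable (𝒬 : PrincipalBundle EP E₀ EG P X₀ G)

/-- Vertical vectors are fundamental vectors. -/
theorem exists_ζ_eq (a : P) (v : TangentSpace 𝓘(ℝ, EP) a)
    (hv : mfderiv 𝓘(ℝ, EP) 𝓘(ℝ, E₀) 𝒬.π a v = 0) : ∃ A, 𝒬.ζ a A = v := by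
  obtain ⟨U, hU, hx, φ, ψ, hφ, hψ, h1, h2, h3⟩ := 𝒬.locally_trivial (𝒬.π a)
  have hn : 𝒬.π ⁻¹' U ∈ 𝓝 a := (hU.preimage 𝒬.π_smooth.continuous).mem_nhds hx
  have dφ : MDifferentiableAt 𝓘(ℝ, EP) 𝓘(ℝ, EG) φ a :=
    (hφ.contMDiffAt hn).mdifferentiableAt FiberProduct.ne_zero_aux
  have dπ := 𝒬.π_smooth.mdifferentiable FiberProduct.ne_zero_aux a
  have dψ : MDifferentiableAt (𝓘(ℝ, E₀).prod 𝓘(ℝ, EG)) 𝓘(ℝ, EP) ψ (𝒬.π a, φ a) :=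
    (hψ.contMDiffAt ((hU.prod isOpen_univ).mem_nhds ⟨hx, trivial⟩)).mdifferentiableAt
      FiberProduct.ne_zero_aux
  have dL : MDifferentiableAt 𝓘(ℝ, EG) 𝓘(ℝ, EG) (fun g : G => (φ a)⁻¹ * g) (φ a) :=
    (contMDiff_const.mul contMDiff_id : ContMDiff 𝓘(ℝ, EG) 𝓘(ℝ, EG) ∞
      fun g : G => (φ a)⁻¹ * g).mdifferentiable FiberProduct.ne_zero_aux _
  have dA := (𝒬.orbit_smooth a).mdifferentiable FiberProduct.ne_zero_aux
  let w : EG := mfderiv 𝓘(ℝ, EP) 𝓘(ℝ, EG) φ a v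
  have k1 : (fun b => ψ (𝒬.π b, φ b)) =ᶠ[𝓝 a] id := by
    filter_upwards [hn] with b hb using h1 b hb
  -- In the trivialisation a vertical `v` becomes `(0, w)`. On the fibre through `a` the inverse
  -- trivialisation is `g ↦ a (φ(a)⁻¹ g)`, so `v` is the image under the orbit map of `w` carried
  -- from `φ a` to `1` by left translation.
  have k2 : ψ ∘ (fun g => (𝒬.π a, g)) = 𝒬.act a ∘ fun g : G => (φ a)⁻¹ * g := by
    funext g
    have hb : 𝒬.π (𝒬.act a ((φ a)⁻¹ * g)) ∈ U := by rw [𝒬.π_act]; exact hx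
    have := h1 _ hb
    rw [h3 a hx, 𝒬.π_act, mul_inv_cancel_left] at this
    exact this
  have m1 := mfderiv_comp_apply a dψ (dπ.prodMk dφ) v
  have m1' : ψ ∘ (fun b => (𝒬.π b, φ b)) =ᶠ[𝓝 a] id := k1
  rw [m1'.mfderiv_eq, mfderiv_id, mfderiv_prodMk dπ dφ] at m1
  have m2 := mfderiv_comp_apply (φ a) (f := fun g => (𝒬.π a, g)) dψ
    (mdifferentiableAt_const.prodMk mdifferentiableAt_id) w
  rw [mfderiv_prodMk (f := fun _ : G => 𝒬.π a) (g := fun g : G => g)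
    mdifferentiableAt_const mdifferentiableAt_id, k2] at m2
  have m3 := mfderiv_comp_apply (φ a) (dA _) dL w
  refine ⟨(mfderiv 𝓘(ℝ, EG) 𝓘(ℝ, EG) (fun g : G => (φ a)⁻¹ * g) (φ a) w : EG), ?_⟩
  refine (mfderiv_apply_congr_point (𝒬.act a) (inv_mul_cancel (φ a)).symm _).trans ?_
  refine m3.symm.trans (m2.trans (Eq.trans ?_ m1.symm))
  refine congrArg _ (Prod.ext ?_ ?_)
  · refine Eq.trans ?_ hv.symm
    show mfderiv 𝓘(ℝ, EG) 𝓘(ℝ, E₀) (fun _ : G => 𝒬.π a) (φ a) w = (0 : E₀)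
    rw [mfderiv_const]; rfl
  · show mfderiv 𝓘(ℝ, EG) 𝓘(ℝ, EG) (id : G → G) (φ a) w = w
    rw [mfderiv_id]; rfl

namespace ConnectionForm

variable {𝒬} (α : 𝒬.ConnectionForm)

/-- A vertical vector annihilated by the connection form vanishes. -/
theorem eq_of_mfderiv_eq {a : P} {v w : TangentSpace 𝓘(ℝ, EP) a}
    (h₁ : mfderiv 𝓘(ℝ, EP) 𝓘(ℝ, E₀) 𝒬.π a v = mfderiv 𝓘(ℝ, EP) 𝓘(ℝ, E₀) 𝒬.π a w)
    (h₂ : α.toFun a v = α.toFun a w) : v = w := by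
  obtain ⟨A, hA⟩ := 𝒬.exists_ζ_eq a (v - w) ((map_sub _ v w).trans (sub_eq_zero.mpr h₁))
  have h3 : A = 0 := by
    rw [← α.fundamental a A, hA, map_sub, h₂, sub_self]
  rw [h3, map_zero] at hA
  exact (sub_eq_zero.mp hA.symm)

/-- Both vectors are vertical and have the same value under `ω`. This is what makes `D` the identity
on `ad(P)`. -/
theorem ζ_toFun_of_vertical {a : P} {v : TangentSpace 𝓘(ℝ, EP) a}
    (hv : mfderiv 𝓘(ℝ, EP) 𝓘(ℝ, E₀) 𝒬.π a v = 0) : 𝒬.ζ a (α.toFun a v) = v :=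
  α.eq_of_mfderiv_eq ((𝒬.dπ_ζ a _ rfl _).trans hv.symm) (α.fundamental a _)

theorem D_retraction (x : X₀) (ξ : 𝒬.Ad x) : α.D x (ξ : 𝒬.At x) = ξ := by
  obtain ⟨ξ, hξ⟩ := ξ
  obtain ⟨v, rfl⟩ := 𝒬.cls_surjective _ (𝒬.π_basePoint x) ξ
  apply Subtype.ext
  exact congrArg (𝒬.cls _ (𝒬.π_basePoint x)) (α.ζ_toFun_of_vertical hξ)

end ConnectionForm

end PrincipalBundle

/-! ### Equivariance, invariance and multiplicativity -/

namespace LieGroupoid.PrincipalBundle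

variable {𝒳 : LieGroupoid E₁ E₀ X₁ X₀} (ℰ : 𝒳.PrincipalBundle EP EG P G)

/-- The action descends from representatives, so it may be computed at any chosen point `a` over `s
γ`. -/
theorem ρAt_cls (ℋ : 𝒳.SourceComplement) (q : ℰ.SourcePullback)
    (v : TangentSpace 𝓘(ℝ, EP) q.snd) :
    ℰ.ρAt ℋ q.fst (ℰ.cls q.snd q.condition.symm v) =
      ℰ.cls (ℰ.μ q) (ℰ.π_μ q) ((ℰ.pullback ℋ).θ q v) := rfl

/-- Arrows carry `ζ_a A` to `ζ_{γ a} A`, so on `[v]` the two sides are the classes at `γ a` of the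
fundamental vectors of `ω (θ̃ v)` and `ω v`. Classes at a fixed point are injective and `ω` inverts
`ζ`, so the classes agree exactly when the values of `ω` do. -/
theorem D_equivariant_iff (ℋ : 𝒳.SourceComplement) (α : ℰ.ConnectionForm) :
    (∀ (γ : X₁) (ξ : ℰ.At (𝒳.s γ)), α.D (𝒳.t γ) (ℰ.ρAt ℋ γ ξ) = ℰ.ρAd ℋ γ (α.D (𝒳.s γ) ξ)) ↔
      ℰ.actionGroupoid.IsForm (ℰ.pullback ℋ) α.toFun := by
  have key : ∀ (q : ℰ.SourcePullback) (v : TangentSpace 𝓘(ℝ, EP) q.snd),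
      (ℰ.ρAd ℋ q.fst (α.D (𝒳.s q.fst) (ℰ.cls q.snd q.condition.symm v)) : ℰ.At (𝒳.t q.fst)) =
        ℰ.cls (ℰ.μ q) (ℰ.π_μ q) (ℰ.ζ (ℰ.μ q) (α.toFun q.snd v)) := fun q v =>
    congrArg (ℰ.cls (ℰ.μ q) (ℰ.π_μ q)) (ℰ.pullback_θ_ζ ℋ q (α.toFun q.snd v))
  rw [isForm_iff]
  constructor
  · intro h q v
    have h1 := (congrArg Subtype.val (h q.fst (ℰ.cls q.snd q.condition.symm v))).trans (key q v)
    have h2 := congrArg (α.toFun (ℰ.μ q)) (ℰ.cls_injective _ _ h1)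
    exact (α.fundamental (ℰ.μ q) _).symm.trans (h2.trans (α.fundamental (ℰ.μ q) _))
  · intro h γ ξ
    obtain ⟨a, ha⟩ := ℰ.π_surjective (𝒳.s γ)
    obtain ⟨v, rfl⟩ := ℰ.cls_surjective a ha ξ
    let q : ℰ.SourcePullback := .mk γ a ha.symm
    apply Subtype.ext
    refine Eq.trans ?_ (key q v).symm
    exact congrArg (fun A => ℰ.cls (ℰ.μ q) (ℰ.π_μ q) (ℰ.ζ (ℰ.μ q) A)) (h q v)

/-- If there is an invariant connection form, then the maps `θ` of `[s^* P ⇉ P]` are multiplicative. -/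
theorem pullback_θ_mult (ℋ : 𝒳.Connection) (α : ℰ.ConnectionForm)
    (hα : ℰ.actionGroupoid.IsForm (ℰ.pullback ℋ.toSourceComplement) α.toFun)
    (γ' γ : X₁) (h : 𝒳.s γ' = 𝒳.t γ) (a : P) (ha : 𝒳.s γ = ℰ.π a) (v : EP) :
    ((ℰ.pullback ℋ.toSourceComplement).θ
      (.mk γ' (ℰ.μ (.mk γ a ha)) (h.trans (ℰ.π_μ (.mk γ a ha)).symm))
      ((ℰ.pullback ℋ.toSourceComplement).θ (.mk γ a ha) v : EP) : EP) =
      (ℰ.pullback ℋ.toSourceComplement).θ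
        (.mk (𝒳.m (.mk γ' γ h)) a ((𝒳.s_m (.mk γ' γ h)).trans ha)) v := by
  rw [isForm_iff] at hα
  set q : ℰ.SourcePullback := .mk γ a ha with hq
  set q' : ℰ.SourcePullback := .mk γ' (ℰ.μ q) (h.trans (ℰ.π_μ q).symm) with hq'
  set r : ℰ.SourcePullback := .mk (𝒳.m (.mk γ' γ h)) a ((𝒳.s_m (.mk γ' γ h)).trans ha) with hr
  have hμ : ℰ.μ q' = ℰ.μ r := ℰ.μ_μ γ' γ a h ha
  -- The points `γ' (γ a)` and `(γ' γ) a` are equal but not by definition; `dπ` and `ω` are moved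
  -- from one to the other.
  have key : ∀ b, b = ℰ.μ r → ∀ w : EP,
      (mfderiv 𝓘(ℝ, EP) 𝓘(ℝ, E₀) ℰ.π b w : E₀) = mfderiv 𝓘(ℝ, EP) 𝓘(ℝ, E₀) ℰ.π (ℰ.μ r) w ∧
      α.toFun b w = α.toFun (ℰ.μ r) w := by
    rintro b rfl w; exact ⟨rfl, rfl⟩
  obtain ⟨k1, k2⟩ := key _ hμ ((ℰ.pullback ℋ.toSourceComplement).θ q'
    ((ℰ.pullback ℋ.toSourceComplement).θ q v : EP))
  -- Compare `dπ` and `ω` of the two sides. The first agree by `ℋ.mult`, since `θ̃` covers `θ`; the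
  -- second by invariance of `ω` under the three arrows `q'`, `q` and `r`.
  refine α.eq_of_mfderiv_eq (a := ℰ.μ r) ?_ ?_
  · refine k1.symm.trans ?_
    refine (ℰ.mfderiv_π_pullback_θ ℋ.toSourceComplement q' _).trans ?_
    refine Eq.trans ?_ (ℰ.mfderiv_π_pullback_θ ℋ.toSourceComplement r v).symm
    refine Eq.trans ?_ (ℋ.mult γ' γ h _)
    exact congrArg (ℋ.θ γ') (ℰ.mfderiv_π_pullback_θ ℋ.toSourceComplement q v)
  · exact k2.symm.trans ((hα q' _).trans ((hα q v).trans (hα r v).symm))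

end LieGroupoid.PrincipalBundle
end Groupoid

/-! ### Smooth families of tangent vectors -/

section TangentCurves

variable {EN : Type*} [NormedAddCommGroup EN] [NormedSpace ℝ EN]
  {N : Type*} [TopologicalSpace N] [ChartedSpace EN N]
  {E : Type*} [NormedAddCommGroup E] [NormedSpace ℝ E]
  {M : Type*} [TopologicalSpace M] [ChartedSpace E M] [IsManifold 𝓘(ℝ, E) ∞ M]
  {E' : Type*} [NormedAddCommGroup E'] [NormedSpace ℝ E']
  {M' : Type*} [TopologicalSpace M'] [ChartedSpace E' M'] [IsManifold 𝓘(ℝ, E') ∞ M']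

theorem TangentBundle.mk_congr {a b : M} (h : a = b) {v w : E} (hv : v = w) :
    (⟨a, v⟩ : TangentBundle 𝓘(ℝ, E) M) = ⟨b, w⟩ := by
  subst h; subst hv; rfl

/-- The differential of a smooth map takes smooth families of tangent vectors to smooth families. -/
theorem ContMDiffOn.mfderiv_tangent {f : M → M'} {O : Set M} (hO : IsOpen O)
    (hf : ContMDiffOn 𝓘(ℝ, E) 𝓘(ℝ, E') ∞ f O) {U : Set N} {a : N → M} {w : N → E}
    (hw : ContMDiffOn 𝓘(ℝ, EN) 𝓘(ℝ, E).tangent ∞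
      (fun y => (⟨a y, w y⟩ : TangentBundle 𝓘(ℝ, E) M)) U) (ha : ∀ y ∈ U, a y ∈ O) :
    ContMDiffOn 𝓘(ℝ, EN) 𝓘(ℝ, E').tangent ∞
      (fun y => (⟨f (a y), mfderiv 𝓘(ℝ, E) 𝓘(ℝ, E') f (a y) (w y)⟩ :
        TangentBundle 𝓘(ℝ, E') M')) U := by
  have h := (hf.contMDiffOn_tangentMapWithin (m := ∞) (by simp) hO.uniqueMDiffOn).comp hw
    fun y hy => ha y hy
  refine h.congr fun y hy => ?_
  exact (tangentMapWithin_eq_tangentMap (p := (⟨a y, w y⟩ : TangentBundle 𝓘(ℝ, E) M))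
    (hO.uniqueMDiffOn _ (ha y hy))
    ((hf.contMDiffAt (hO.mem_nhds (ha y hy))).mdifferentiableAt FiberProduct.ne_zero_aux)).symm

/-- The tangent bundle of a vector space is globally trivial, with trivial coordinate changes. -/
theorem contMDiffOn_tangent_model_iff {U : Set N} {a : N → E} {w : N → E} :
    ContMDiffOn 𝓘(ℝ, EN) 𝓘(ℝ, E).tangent ∞
      (fun y => (⟨a y, w y⟩ : TangentBundle 𝓘(ℝ, E) E)) U ↔
    ContMDiffOn 𝓘(ℝ, EN) 𝓘(ℝ, E) ∞ a U ∧ ContMDiffOn 𝓘(ℝ, EN) 𝓘(ℝ, E) ∞ w U := by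
  constructor
  · intro h
    exact ⟨fun x hx => (Bundle.contMDiffWithinAt_totalSpace.mp (h x hx)).1,
      fun x hx => by simpa using (Bundle.contMDiffWithinAt_totalSpace.mp (h x hx)).2⟩
  · rintro ⟨h1, h2⟩ x hx
    exact Bundle.contMDiffWithinAt_totalSpace.mpr ⟨h1 x hx, by simpa using h2 x hx⟩

theorem ContMDiffOn.base_of_tangent {U : Set N} {a : N → M} {w : N → E}
    (h : ContMDiffOn 𝓘(ℝ, EN) 𝓘(ℝ, E).tangent ∞
      (fun y => (⟨a y, w y⟩ : TangentBundle 𝓘(ℝ, E) M)) U) :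
    ContMDiffOn 𝓘(ℝ, EN) 𝓘(ℝ, E) ∞ a U :=
  fun x hx => (Bundle.contMDiffWithinAt_totalSpace.mp (h x hx)).1

theorem mdifferentiable_of_mem_maximalAtlas {φ : OpenPartialHomeomorph M E}
    (hφ : φ ∈ IsManifold.maximalAtlas 𝓘(ℝ, E) ∞ M) : φ.MDifferentiable 𝓘(ℝ, E) 𝓘(ℝ, E) :=
  ⟨(contMDiffOn_of_mem_maximalAtlas hφ).mdifferentiableOn FiberProduct.ne_zero_aux,
    (contMDiffOn_symm_of_mem_maximalAtlas hφ).mdifferentiableOn FiberProduct.ne_zero_aux⟩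

/-- Smoothness of a family of tangent vectors can be checked in a chart. -/
theorem contMDiffOn_tangent_of_chart {φ : OpenPartialHomeomorph M E}
    (hφ : φ ∈ IsManifold.maximalAtlas 𝓘(ℝ, E) ∞ M) {U : Set N} {a : N → M} {w : N → E}
    (ha : ContMDiffOn 𝓘(ℝ, EN) 𝓘(ℝ, E) ∞ a U) (haφ : ∀ y ∈ U, a y ∈ φ.source)
    (hw : ContMDiffOn 𝓘(ℝ, EN) 𝓘(ℝ, E) ∞
      (fun y => (mfderiv 𝓘(ℝ, E) 𝓘(ℝ, E) φ (a y) (w y) : E)) U) :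
    ContMDiffOn 𝓘(ℝ, EN) 𝓘(ℝ, E).tangent ∞
      (fun y => (⟨a y, w y⟩ : TangentBundle 𝓘(ℝ, E) M)) U := by
  -- The family is the image of its chart expression under the differential of `φ⁻¹`.
  have h1 := (contMDiffOn_symm_of_mem_maximalAtlas hφ).mfderiv_tangent φ.open_target
    (contMDiffOn_tangent_model_iff.mpr
      ⟨(contMDiffOn_of_mem_maximalAtlas hφ).comp ha haφ, hw⟩) fun y hy => φ.map_source (haφ y hy)
  refine h1.congr fun y hy => ?_
  refine TangentBundle.mk_congr (φ.left_inv (haφ y hy)).symm ?_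
  have h2 := (mdifferentiable_of_mem_maximalAtlas hφ).symm_comp_deriv (haφ y hy)
  exact (congrArg (fun T : E →L[ℝ] E => T (w y)) h2).symm

/-- In a submersion chart, tangent vectors of the codomain lift smoothly along the submersion. -/
theorem exists_contMDiffOn_tangent_lift {f : M → M'}
    (hf : IsSubmersion 𝓘(ℝ, E) 𝓘(ℝ, E') ∞ f) {U : Set N} (hU : IsOpen U) {a : N → M} {v : N → E'}
    (ha : ContMDiffOn 𝓘(ℝ, EN) 𝓘(ℝ, E) ∞ a U)
    (hv : ContMDiffOn 𝓘(ℝ, EN) 𝓘(ℝ, E').tangent ∞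
      (fun y => (⟨f (a y), v y⟩ : TangentBundle 𝓘(ℝ, E') M')) U) {y₀ : N} (hy₀ : y₀ ∈ U) :
    ∃ V, IsOpen V ∧ y₀ ∈ V ∧ ∃ w : N → E,
      ContMDiffOn 𝓘(ℝ, EN) 𝓘(ℝ, E).tangent ∞
        (fun y => (⟨a y, w y⟩ : TangentBundle 𝓘(ℝ, E) M)) (U ∩ V) ∧
      ∀ y ∈ U ∩ V, (mfderiv 𝓘(ℝ, E) 𝓘(ℝ, E') f (a y) (w y) : E') = v y := by
  set S := FiberProduct.submersionAt hf (a y₀) with hS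
  have hφ := mdifferentiable_of_mem_maximalAtlas S.domChart_mem_maximalAtlas
  have hχ := mdifferentiable_of_mem_maximalAtlas S.codChart_mem_maximalAtlas
  -- In a submersion chart `f` is the first projection, so the coordinates of `v` completed by the
  -- vertical component `0` give a lift; `w` is this vector carried back by the inverse chart.
  let z : N → E := fun y => S.equiv.symm
    ((mfderiv 𝓘(ℝ, E') 𝓘(ℝ, E') S.codChart (f (a y)) (v y) : E'), 0)
  let w : N → E := fun y => mfderiv 𝓘(ℝ, E) 𝓘(ℝ, E) S.domChart.symm (S.domChart (a y)) (z y)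
  let V := U ∩ a ⁻¹' S.domChart.source
  have hVo : IsOpen V := ha.continuousOn.isOpen_inter_preimage hU S.domChart.open_source
  have hdw : ∀ y ∈ V, (mfderiv 𝓘(ℝ, E) 𝓘(ℝ, E) S.domChart (a y) (w y) : E) = z y := fun y hy => by
    have h := hφ.comp_symm_deriv (S.domChart.map_source hy.2)
    have h' := congrArg (fun T : E →L[ℝ] E => T (z y)) h
    have key : ∀ b, b = a y → ∀ u : E, (mfderiv 𝓘(ℝ, E) 𝓘(ℝ, E) S.domChart b u : E) =
      mfderiv 𝓘(ℝ, E) 𝓘(ℝ, E) S.domChart (a y) u := by rintro b rfl u; rfl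
    exact (key _ (S.domChart.left_inv hy.2) _).symm.trans h'
  refine ⟨V, hVo, ⟨hy₀, S.mem_domChart_source⟩, w, ?_, ?_⟩
  · refine contMDiffOn_tangent_of_chart S.domChart_mem_maximalAtlas
      (ha.mono Set.inter_subset_left) (fun y hy => hy.2.2) ?_
    refine ContMDiffOn.congr ?_ fun y hy => hdw y hy.2
    have h1 := (contMDiffOn_tangent_model_iff.mp
      ((contMDiffOn_of_mem_maximalAtlas S.codChart_mem_maximalAtlas).mfderiv_tangent
        S.codChart.open_source (hv.mono (Set.inter_subset_left (t := V)))
        fun y hy => S.mapsto_domChart_source_codChart_source hy.2.2)).2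
    exact S.equiv.symm.contDiff.contMDiff.comp_contMDiffOn (h1.prodMk_space contMDiffOn_const)
  · intro y hy
    have hs := S.mapsto_domChart_source_codChart_source hy.2.2
    apply hχ.mfderiv_injective hs
    have h3 : S.codChart ∘ f =ᶠ[𝓝 (a y)]
        fun x => ((ContinuousLinearMap.fst ℝ E' hf.complement) ∘L
          (S.equiv : E →L[ℝ] E' × hf.complement)) (S.domChart x) := by
      filter_upwards [S.domChart.open_source.mem_nhds hy.2.2] with x hx
      exact FiberProduct.codChart_apply hf _ hx
    have h4 := FiberProduct.mfderiv_clm_comp ((ContinuousLinearMap.fst ℝ E' hf.complement) ∘L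
      (S.equiv : E →L[ℝ] E' × hf.complement)) (hφ.mdifferentiableAt hy.2.2) (w y)
    have h5 := mfderiv_comp_apply (a y) (hχ.mdifferentiableAt hs)
      (hf.contMDiff.mdifferentiable FiberProduct.ne_zero_aux (a y)) (w y)
    rw [h3.mfderiv_eq] at h5
    refine h5.symm.trans (h4.trans ?_)
    refine (congrArg (fun u : E => (S.equiv u).1) (hdw y hy.2)).trans ?_
    exact congrArg Prod.fst (S.equiv.apply_symm_apply _)

end TangentCurves

/-! ### Smooth families of tangent vectors of a fibre product -/

section FiberProduct

variable {EA : Type*} [NormedAddCommGroup EA] [NormedSpace ℝ EA]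
  {EB : Type*} [NormedAddCommGroup EB] [NormedSpace ℝ EB]
  {EC : Type*} [NormedAddCommGroup EC] [NormedSpace ℝ EC]
  {A : Type*} [TopologicalSpace A] [ChartedSpace EA A]
  {B : Type*} [TopologicalSpace B] [ChartedSpace EB B]
  {C : Type*} [TopologicalSpace C] [ChartedSpace EC C]
  {f : A → C} {g : B → C}
  {hf : IsSubmersion 𝓘(ℝ, EA) 𝓘(ℝ, EC) ∞ f} {hg : ContMDiff 𝓘(ℝ, EB) 𝓘(ℝ, EC) ∞ g}
  [IsManifold 𝓘(ℝ, EA) ∞ A] [IsManifold 𝓘(ℝ, EB) ∞ B] [IsManifold 𝓘(ℝ, EC) ∞ C]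
  {EN : Type*} [NormedAddCommGroup EN] [NormedSpace ℝ EN]
  {N : Type*} [TopologicalSpace N] [ChartedSpace EN N] [IsManifold 𝓘(ℝ, EN) ∞ N]

/-- A family of tangent vectors of the fibre product is smooth if its two components are. -/
theorem FiberProduct.contMDiffOn_tangent {U : Set N} (hU : IsOpen U)
    {q : N → FiberProduct hf hg} {z : N → hf.complement × EB}
    (h₁ : ContMDiffOn 𝓘(ℝ, EN) 𝓘(ℝ, EA).tangent ∞
      (fun y => (⟨(q y).fst, mfderiv 𝓘(ℝ, hf.complement × EB) 𝓘(ℝ, EA) fst (q y) (z y)⟩ :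
        TangentBundle 𝓘(ℝ, EA) A)) U)
    (h₂ : ContMDiffOn 𝓘(ℝ, EN) 𝓘(ℝ, EB).tangent ∞
      (fun y => (⟨(q y).snd, mfderiv 𝓘(ℝ, hf.complement × EB) 𝓘(ℝ, EB) snd (q y) (z y)⟩ :
        TangentBundle 𝓘(ℝ, EB) B)) U) :
    ContMDiffOn 𝓘(ℝ, EN) 𝓘(ℝ, hf.complement × EB).tangent ∞
      (fun y => (⟨q y, z y⟩ : TangentBundle 𝓘(ℝ, hf.complement × EB) (FiberProduct hf hg))) U := by
  have hq : ContMDiffOn 𝓘(ℝ, EN) 𝓘(ℝ, hf.complement × EB) ∞ q U :=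
    contMDiffOn_iff.mpr ⟨h₁.base_of_tangent, h₂.base_of_tangent⟩
  refine contMDiffOn_of_locally_contMDiffOn fun y₀ hy₀ => ?_
  let p := q y₀
  let S := submersionAt hf p.fst
  let V := U ∩ q ⁻¹' (chartAt (hf.complement × EB) p).source
  have hVo : IsOpen V := hq.continuousOn.isOpen_inter_preimage hU (chartAt _ p).open_source
  refine ⟨V, hVo, ⟨hy₀, mem_chart_source (hf.complement × EB) p⟩, ?_⟩
  -- The chart at `p` is made of the vertical coordinate of the first projection and a chart of the
  -- second, so its differential on `z` depends only on the two component families.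
  have hc : ContMDiffOn 𝓘(ℝ, EA) 𝓘(ℝ, hf.complement) ∞
      (fun x => (S.equiv (S.domChart x)).2) S.domChart.source :=
    (contDiff_snd.comp S.equiv.contDiff).contMDiff.comp_contMDiffOn
      (contMDiffOn_of_mem_maximalAtlas S.domChart_mem_maximalAtlas)
  have k1 := (contMDiffOn_tangent_model_iff.mp
    (hc.mfderiv_tangent S.domChart.open_source (h₁.mono (Set.inter_subset_left (t := V)))
      fun y hy => hy.2.2.1)).2
  have k2 := (contMDiffOn_tangent_model_iff.mp
    ((contMDiffOn_chart (I := 𝓘(ℝ, EB)) (n := ∞) (x := p.snd)).mfderiv_tangent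
      (chartAt EB p.snd).open_source (h₂.mono (Set.inter_subset_left (t := V)))
      fun y hy => hy.2.2.2)).2
  refine contMDiffOn_tangent_of_chart (IsManifold.chart_mem_maximalAtlas p)
    (hq.mono Set.inter_subset_left) (fun y hy => hy.2.2) ?_
  refine (k1.prodMk_space k2).congr fun y hy => ?_
  have hκ := (mdifferentiable_chart (I := 𝓘(ℝ, hf.complement × EB)) p).mdifferentiableAt hy.2.2
  refine Prod.ext ?_ ?_
  · have m1 := mfderiv_comp_apply (q y)
      ((hc.contMDiffAt (S.domChart.open_source.mem_nhds hy.2.2.1)).mdifferentiableAt ne_zero_aux)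
      (contMDiff_fst.mdifferentiable ne_zero_aux (q y)) (z y)
    exact (mfderiv_clm_comp (ContinuousLinearMap.fst ℝ hf.complement EB) hκ (z y)).symm.trans m1
  · have m1 := mfderiv_comp_apply (q y)
      (mdifferentiableAt_atlas (I := 𝓘(ℝ, EB)) (chart_mem_atlas EB p.snd) hy.2.2.2)
      (contMDiff_snd.mdifferentiable ne_zero_aux (q y)) (z y)
    exact (mfderiv_clm_comp (ContinuousLinearMap.snd ℝ hf.complement EB) hκ (z y)).symm.trans m1

end FiberProduct

/-! ### Smoothness of horizontal lifts and of the actions -/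

section Groupoid

variable {E₁ : Type*} [NormedAddCommGroup E₁] [NormedSpace ℝ E₁]
  {E₀ : Type*} [NormedAddCommGroup E₀] [NormedSpace ℝ E₀]
  {EP : Type*} [NormedAddCommGroup EP] [NormedSpace ℝ EP]
  {EG : Type*} [NormedAddCommGroup EG] [NormedSpace ℝ EG]
  {X₁ : Type*} [TopologicalSpace X₁] [ChartedSpace E₁ X₁] [IsManifold 𝓘(ℝ, E₁) ∞ X₁]
  {X₀ : Type*} [TopologicalSpace X₀] [ChartedSpace E₀ X₀] [IsManifold 𝓘(ℝ, E₀) ∞ X₀]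
  {P : Type*} [TopologicalSpace P] [ChartedSpace EP P] [IsManifold 𝓘(ℝ, EP) ∞ P]
  {G : Type*} [TopologicalSpace G] [ChartedSpace EG G] [Group G] [LieGroup 𝓘(ℝ, EG) ∞ G]
  {EN : Type*} [NormedAddCommGroup EN] [NormedSpace ℝ EN]
  {N : Type*} [TopologicalSpace N] [ChartedSpace EN N]

namespace LieGroupoid

variable {𝒳 : LieGroupoid E₁ E₀ X₁ X₀}

/-- A connection provides only a smooth `P_H`. Any local smooth lift of `v` through the submersion
`s` is sent by `P_H` to the horizontal lift. -/
theorem Connection.contMDiffOn_lift (ℋ : 𝒳.Connection) {U : Set N} (hU : IsOpen U)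
    {c : N → X₁} {v : N → E₀} (hc : ContMDiffOn 𝓘(ℝ, EN) 𝓘(ℝ, E₁) ∞ c U)
    (hv : ContMDiffOn 𝓘(ℝ, EN) 𝓘(ℝ, E₀).tangent ∞
      (fun y => (⟨𝒳.s (c y), v y⟩ : TangentBundle 𝓘(ℝ, E₀) X₀)) U) :
    ContMDiffOn 𝓘(ℝ, EN) 𝓘(ℝ, E₁).tangent ∞
      (fun y => (⟨c y, ℋ.lift (c y) (v y)⟩ : TangentBundle 𝓘(ℝ, E₁) X₁)) U := by
  refine contMDiffOn_of_locally_contMDiffOn fun y₀ hy₀ => ?_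
  obtain ⟨V, hV, hy, w, hw, hws⟩ := exists_contMDiffOn_tangent_lift 𝒳.s_submersion hU hc hv hy₀
  refine ⟨V, hV, hy, (ℋ.smooth.comp_contMDiffOn hw).congr fun y hy => ?_⟩
  refine TangentBundle.mk_congr rfl ?_
  exact ((ℋ.proj_eq_lift (c y) (w y)).trans (congrArg (ℋ.lift (c y)) (hws y hy))).symm

/-- This part of condition 1 needs no invariant form: the algebraic axioms are `θ_unit` and
`ℋ.mult`, and smoothness is that of the lift followed by `dt`. -/
theorem Connection.isVectorBundle_tangent (ℋ : 𝒳.Connection) :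
    𝒳.IsVectorBundle (fun x => TangentSpace 𝓘(ℝ, E₀) x) tangentPlots ℋ.θ where
  unit x ξ := by
    have key : ∀ (y z : X₀), y = z → ∀ v w : E₀, v = w →
        (⟨y, v⟩ : (x : X₀) × TangentSpace 𝓘(ℝ, E₀) x) = ⟨z, w⟩ := by
      rintro y _ rfl v _ rfl; rfl
    exact key _ _ ((𝒳.t_e x).trans (𝒳.s_e x).symm) _ _ (ℋ.θ_unit x ξ)
  mult γ' γ h ξ η χ hη hχ := by
    have key : ∀ (y z : X₀), y = z → ∀ v w : E₀, v = w →
        (⟨y, v⟩ : (x : X₀) × TangentSpace 𝓘(ℝ, E₀) x) = ⟨z, w⟩ := by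
      rintro y _ rfl v _ rfl; rfl
    have key' : ∀ p q : (x : X₀) × TangentSpace 𝓘(ℝ, E₀) x, p = q → (p.2 : E₀) = q.2 := by
      rintro p _ rfl; rfl
    have h1 : (η : E₀) = ℋ.θ γ ξ := key' _ _ hη
    have h2 : (χ : E₀) = ξ := key' _ _ hχ
    refine key _ _ (𝒳.t_m _) _ _ ?_
    refine (congrArg (ℋ.θ (𝒳.m (.mk γ' γ h))) h2).trans ?_
    exact (ℋ.mult γ' γ h ξ).symm.trans (congrArg (ℋ.θ γ') h1.symm)
  smooth n c ξ hc hξ := by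
    have h1 := ℋ.contMDiffOn_lift isOpen_univ (v := ξ) hc.contMDiffOn (contMDiffOn_univ.mpr hξ)
    have h2 := 𝒳.t_smooth.contMDiffOn.mfderiv_tangent isOpen_univ h1 fun _ _ => trivial
    exact contMDiffOn_univ.mp h2

namespace PrincipalBundle

variable (ℰ : 𝒳.PrincipalBundle EP EG P G)

/-- The components of the lift are the horizontal lift of `dπ v` in `X₁` and `v` itself, and both
vary smoothly. -/
theorem contMDiffOn_pullback_lift [IsManifold 𝓘(ℝ, EN) ∞ N] (ℋ : 𝒳.Connection)
    {U : Set N} (hU : IsOpen U)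
    {q : N → ℰ.SourcePullback} {v : N → EP}
    (hq : ContMDiffOn 𝓘(ℝ, EN) 𝓘(ℝ, 𝒳.s_submersion.complement × EP) ∞ q U)
    (hv : ContMDiffOn 𝓘(ℝ, EN) 𝓘(ℝ, EP).tangent ∞
      (fun y => (⟨(q y).snd, v y⟩ : TangentBundle 𝓘(ℝ, EP) P)) U) :
    ContMDiffOn 𝓘(ℝ, EN) 𝓘(ℝ, 𝒳.s_submersion.complement × EP).tangent ∞
      (fun y => (⟨q y, (ℰ.pullback ℋ.toSourceComplement).lift (q y) (v y)⟩ :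
        TangentBundle 𝓘(ℝ, 𝒳.s_submersion.complement × EP) ℰ.SourcePullback)) U := by
  have h1 := ℰ.π_smooth.contMDiffOn.mfderiv_tangent isOpen_univ hv fun _ _ => trivial
  have h2 := ℋ.contMDiffOn_lift hU (FiberProduct.contMDiff_fst.comp_contMDiffOn hq)
    (v := fun y => (mfderiv 𝓘(ℝ, EP) 𝓘(ℝ, E₀) ℰ.π (q y).snd (v y) : E₀))
    (h1.congr fun y _ => TangentBundle.mk_congr (q y).condition rfl)
  refine FiberProduct.contMDiffOn_tangent hU ?_ ?_
  · refine h2.congr fun y _ => TangentBundle.mk_congr rfl ?_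
    exact ℰ.mfderiv_fst_lift ℋ.toSourceComplement (q y) (v y)
  · refine hv.congr fun y _ => TangentBundle.mk_congr rfl ?_
    exact (ℰ.pullback ℋ.toSourceComplement).mfderiv_lift (q y) (v y)

theorem contMDiffOn_pullback_θ [IsManifold 𝓘(ℝ, EN) ∞ N] (ℋ : 𝒳.Connection)
    {U : Set N} (hU : IsOpen U)
    {q : N → ℰ.SourcePullback} {v : N → EP}
    (hq : ContMDiffOn 𝓘(ℝ, EN) 𝓘(ℝ, 𝒳.s_submersion.complement × EP) ∞ q U)
    (hv : ContMDiffOn 𝓘(ℝ, EN) 𝓘(ℝ, EP).tangent ∞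
      (fun y => (⟨(q y).snd, v y⟩ : TangentBundle 𝓘(ℝ, EP) P)) U) :
    ContMDiffOn 𝓘(ℝ, EN) 𝓘(ℝ, EP).tangent ∞
      (fun y => (⟨ℰ.μ (q y), (ℰ.pullback ℋ.toSourceComplement).θ (q y) (v y)⟩ :
        TangentBundle 𝓘(ℝ, EP) P)) U :=
  ℰ.μ_smooth.contMDiffOn.mfderiv_tangent isOpen_univ
    (ℰ.contMDiffOn_pullback_lift ℋ hU hq hv) fun _ _ => trivial

end PrincipalBundle
end LieGroupoid

/-! ### The total space of `At(P)` and smoothness of `D` -/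

namespace PrincipalBundle

variable (𝒬 : PrincipalBundle EP E₀ EG P X₀ G)

/-- The vector bundle axioms are equations in the total space, where base points agree only
propositionally; this reduces them to representatives. -/
theorem sigma_cls_congr {x x' : X₀} {a b : P} (h : 𝒬.π a = x) (h' : 𝒬.π b = x') (hab : a = b)
    {v w : EP} (hvw : v = w) :
    (⟨x, 𝒬.cls a h v⟩ : (x : X₀) × 𝒬.At x) = ⟨x', 𝒬.cls b h' w⟩ := by
  subst hab; subst hvw; subst h; subst h'; rfl

theorem eq_cls_of_sigma_eq {x x' : X₀} {ξ : 𝒬.At x'} {a : P} {h : 𝒬.π a = x}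
    {v : TangentSpace 𝓘(ℝ, EP) a}
    (e : (⟨x', ξ⟩ : (x : X₀) × 𝒬.At x) = ⟨x, 𝒬.cls a h v⟩) :
    ∃ h' : 𝒬.π a = x', ξ = 𝒬.cls a h' v := by
  cases e
  exact ⟨h, rfl⟩

theorem sigma_ad_injective : Function.Injective
    (fun p : (x : X₀) × 𝒬.Ad x => (⟨p.1, (p.2 : 𝒬.At p.1)⟩ : (x : X₀) × 𝒬.At x)) := by
  rintro ⟨x, ξ, hξ⟩ ⟨x', η, hη⟩ h
  cases h
  rfl

/-- Writing `ζ_a A` through the full action map `P × G → P` makes its smooth dependence on `a`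
accessible. -/
theorem mfderiv_act_prod (a : P) (A : EG) :
    (mfderiv (𝓘(ℝ, EP).prod 𝓘(ℝ, EG)) 𝓘(ℝ, EP) (fun q : P × G => 𝒬.act q.1 q.2) (a, 1)
      ((0, A) : EP × EG) : EP) = 𝒬.ζ a A := by
  have m := mfderiv_comp_apply (1 : G) (f := fun g : G => (a, g))
    (𝒬.act_smooth.mdifferentiable FiberProduct.ne_zero_aux _)
    (mdifferentiableAt_const.prodMk mdifferentiableAt_id) A
  rw [mfderiv_prodMk (f := fun _ : G => a) (g := fun g : G => g)
    mdifferentiableAt_const mdifferentiableAt_id] at m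
  refine Eq.trans ?_ m.symm
  refine congrArg _ (Prod.ext ?_ ?_)
  · show (0 : EP) = mfderiv 𝓘(ℝ, EG) 𝓘(ℝ, EP) (fun _ : G => a) 1 A
    rw [mfderiv_const]; rfl
  · show A = mfderiv 𝓘(ℝ, EG) 𝓘(ℝ, EG) (id : G → G) 1 A
    rw [mfderiv_id]; rfl

/-- The family is the image, under the tangent map of the action, of the zero vector at `a y` paired
with `A y` at `1`. -/
theorem contMDiffOn_ζ {U : Set N} {a : N → P} {A : N → EG}
    (ha : ContMDiffOn 𝓘(ℝ, EN) 𝓘(ℝ, EP) ∞ a U) (hA : ContMDiffOn 𝓘(ℝ, EN) 𝓘(ℝ, EG) ∞ A U) :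
    ContMDiffOn 𝓘(ℝ, EN) 𝓘(ℝ, EP).tangent ∞
      (fun y => (⟨a y, 𝒬.ζ (a y) (A y)⟩ : TangentBundle 𝓘(ℝ, EP) P)) U := by
  have h1 : ContMDiffOn 𝓘(ℝ, EN) 𝓘(ℝ, EP).tangent ∞
      (fun y => (⟨a y, (0 : EP)⟩ : TangentBundle 𝓘(ℝ, EP) P)) U :=
    (Bundle.contMDiff_zeroSection ℝ (TangentSpace 𝓘(ℝ, EP) : P → Type _)).comp_contMDiffOn ha
  have h2 : ContMDiffOn 𝓘(ℝ, EN) 𝓘(ℝ, EG).tangent ∞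
      (fun y => (⟨1, A y⟩ : TangentBundle 𝓘(ℝ, EG) G)) U := by
    refine contMDiffOn_tangent_of_chart (IsManifold.chart_mem_maximalAtlas (1 : G))
      contMDiffOn_const (fun _ _ => mem_chart_source EG (1 : G)) ?_
    exact (show EG →L[ℝ] EG from mfderiv 𝓘(ℝ, EG) 𝓘(ℝ, EG)
      (chartAt EG (1 : G)) (1 : G)).contMDiff.comp_contMDiffOn hA
  have h3 := (contMDiff_equivTangentBundleProd_symm (n := ∞) (I := 𝓘(ℝ, EP)) (M := P)
    (I' := 𝓘(ℝ, EG)) (M' := G)).comp_contMDiffOn (h1.prodMk h2)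
  have h4 := (𝒬.act_smooth.contMDiff_tangentMap (m := ∞) (by simp)).comp_contMDiffOn h3
  refine h4.congr fun y _ => TangentBundle.mk_congr (𝒬.act_one (a y)).symm ?_
  exact (𝒬.mfderiv_act_prod (a y) (A y)).symm

/-- If `r` is a local lift of `p` to `TP`, then `ζ (ω r)` is a local lift of `D p`. -/
theorem ConnectionForm.D_smooth {𝒬 : PrincipalBundle EP E₀ EG P X₀ G} (α : 𝒬.ConnectionForm) (n : ℕ)
    (p : EuclideanSpace ℝ (Fin n) → (x : X₀) × 𝒬.At x) (hp : 𝒬.atPlots n p) :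
    𝒬.adPlots n (fun y => ⟨(p y).1, α.D (p y).1 (p y).2⟩) := by
  intro y₀
  obtain ⟨U, hU, hy, r, hr, hpr⟩ := hp y₀
  refine ⟨U, hU, hy, fun y => ⟨(r y).1, 𝒬.ζ (r y).1 (α.toFun (r y).1 (r y).2)⟩, ?_, ?_⟩
  · exact 𝒬.contMDiffOn_ζ ((Bundle.contMDiff_proj _).comp_contMDiffOn hr)
      (α.smooth.comp_contMDiffOn hr)
  · intro y hy
    show (⟨(p y).1, (α.D (p y).1 (p y).2 : 𝒬.At (p y).1)⟩ : (x : X₀) × 𝒬.At x) = _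
    rw [hpr y hy]
    rfl

end PrincipalBundle

/-! ### Vector bundles over the groupoid and the equivalences -/

namespace LieGroupoid.PrincipalBundle

variable {𝒳 : LieGroupoid E₁ E₀ X₁ X₀} (ℰ : 𝒳.PrincipalBundle EP EG P G)

theorem ρAt_smooth (ℋ : 𝒳.Connection) (n : ℕ) (c : EuclideanSpace ℝ (Fin n) → X₁)
    (ξ : ∀ y, ℰ.At (𝒳.s (c y)))
    (hc : ContMDiff 𝓘(ℝ, EuclideanSpace ℝ (Fin n)) 𝓘(ℝ, E₁) ∞ c)
    (hξ : ℰ.atPlots n (fun y => ⟨𝒳.s (c y), ξ y⟩)) :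
    ℰ.atPlots n (fun y => ⟨𝒳.t (c y), ℰ.ρAt ℋ.toSourceComplement (c y) (ξ y)⟩) := by
  classical
  intro y₀
  obtain ⟨U, hU, hy₀, r, hr, hpr⟩ := hξ y₀
  have hb : ∀ y ∈ U, 𝒳.s (c y) = ℰ.π (r y).1 := fun y hy => congrArg Sigma.fst (hpr y hy)
  -- The pair of `c y` and the base point of `r y` is known to lie in `s^* P` only for `y ∈ U`. The
  -- value at `y₀` serves as a default elsewhere; smoothness is claimed on `U` only.
  let q : EuclideanSpace ℝ (Fin n) → ℰ.SourcePullback := fun y =>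
    if h : 𝒳.s (c y) = ℰ.π (r y).1 then .mk (c y) (r y).1 h
    else .mk (c y₀) (r y₀).1 (hb y₀ hy₀)
  have hq : ∀ y ∈ U, ∃ h, q y = .mk (c y) (r y).1 h := fun y hy => ⟨hb y hy, dif_pos (hb y hy)⟩
  have hq₁ : ∀ y ∈ U, (q y).fst = c y := fun y hy => by
    obtain ⟨h, e⟩ := hq y hy; rw [e]; rfl
  have hq₂ : ∀ y ∈ U, (q y).snd = (r y).1 := fun y hy => by
    obtain ⟨h, e⟩ := hq y hy; rw [e]; rfl
  have hqs : ContMDiffOn 𝓘(ℝ, EuclideanSpace ℝ (Fin n))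
      𝓘(ℝ, 𝒳.s_submersion.complement × EP) ∞ q U :=
    FiberProduct.contMDiffOn_iff.mpr ⟨hc.contMDiffOn.congr hq₁,
      ((Bundle.contMDiff_proj _).comp_contMDiffOn hr).congr hq₂⟩
  refine ⟨U, hU, hy₀, _, ℰ.contMDiffOn_pullback_θ ℋ hU (v := fun y => ((r y).2 : EP)) hqs
    (hr.congr fun y hy => TangentBundle.mk_congr (hq₂ y hy) rfl), fun y hy => ?_⟩
  obtain ⟨h', e'⟩ := ℰ.eq_cls_of_sigma_eq (hpr y hy)
  obtain ⟨h, e⟩ := hq y hy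
  show (⟨𝒳.t (c y), ℰ.ρAt ℋ.toSourceComplement (c y) (ξ y)⟩ : (x : X₀) × ℰ.At x) = _
  rw [e']
  exact ℰ.sigma_cls_congr (a := ℰ.μ (.mk (c y) (r y).1 h)) (ℰ.π_μ _) rfl
    (congrArg ℰ.μ e.symm)
    ((ℰ.pullback ℋ.toSourceComplement).θ_congr e.symm ((r y).2 : EP))

/-- If there is an invariant connection form, then `At(P)` is a vector bundle over `𝒳`. -/
theorem isVectorBundle_at (ℋ : 𝒳.Connection) (α : ℰ.ConnectionForm)
    (hα : ℰ.actionGroupoid.IsForm (ℰ.pullback ℋ.toSourceComplement) α.toFun) :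
    𝒳.IsVectorBundle ℰ.At ℰ.atPlots (ℰ.ρAt ℋ.toSourceComplement) where
  unit x ξ := by
    obtain ⟨a, rfl⟩ := ℰ.π_surjective x
    obtain ⟨v, rfl⟩ := ℰ.cls_surjective a (𝒳.s_e (ℰ.π a)).symm ξ
    exact ℰ.sigma_cls_congr _ _ (ℰ.μ_e a) (ℰ.pullback_θ_unit ℋ a v)
  mult γ' γ h ξ η χ hη hχ := by
    obtain ⟨a, ha⟩ := ℰ.π_surjective (𝒳.s γ)
    obtain ⟨v, rfl⟩ := ℰ.cls_surjective a ha ξ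
    -- With `ξ` represented by `v` at `a`, the element `η` is represented by `θ̃ v` at `γ a` and `χ`
    -- by `v` at `a`, so the axiom becomes `pullback_θ_mult`.
    obtain ⟨h₁, rfl⟩ := ℰ.eq_cls_of_sigma_eq (hη.trans (congrArg (Sigma.mk (𝒳.t γ))
      (ℰ.ρAt_cls ℋ.toSourceComplement (.mk γ a ha.symm) v)))
    obtain ⟨h₂, rfl⟩ := ℰ.eq_cls_of_sigma_eq hχ
    exact ℰ.sigma_cls_congr _ _ (ℰ.μ_μ γ' γ a h ha.symm).symm
      (ℰ.pullback_θ_mult ℋ α hα γ' γ h a ha.symm v).symm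
  smooth := ℰ.ρAt_smooth ℋ

/-- If `At(P)` is a vector bundle over `𝒳`, then so is `ad(P)`. -/
theorem isVectorBundle_ad (ℋ : 𝒳.SourceComplement)
    (h : 𝒳.IsVectorBundle ℰ.At ℰ.atPlots (ℰ.ρAt ℋ)) :
    𝒳.IsVectorBundle (fun x => ℰ.Ad x) ℰ.adPlots (ℰ.ρAd ℋ) where
  unit x ξ := ℰ.sigma_ad_injective (h.unit x ξ)
  mult γ' γ hγ ξ η χ hη hχ := ℰ.sigma_ad_injective
    (h.mult γ' γ hγ ξ η χ
      (congrArg (fun p : (x : X₀) × ℰ.Ad x => (⟨p.1, (p.2 : ℰ.At p.1)⟩ : (x : X₀) × ℰ.At x)) hη)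
      (congrArg (fun p : (x : X₀) × ℰ.Ad x => (⟨p.1, (p.2 : ℰ.At p.1)⟩ : (x : X₀) × ℰ.At x)) hχ))
  smooth n c ξ hc hξ := h.smooth n c (fun y => ξ y) hc hξ

/-- Smoothness and retraction hold for every connection form, so equivariance is the only condition.
-/
theorem isEquivariantSplitting_iff (ℋ : 𝒳.Connection) (α : ℰ.ConnectionForm) :
    ℰ.IsEquivariantSplitting ℋ α.D ↔
      ℰ.actionGroupoid.IsForm (ℰ.pullback ℋ.toSourceComplement) α.toFun :=
  ⟨fun h => (ℰ.D_equivariant_iff ℋ.toSourceComplement α).mp h.equivariant,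
    fun h => ⟨α.D_smooth, α.D_retraction, (ℰ.D_equivariant_iff ℋ.toSourceComplement α).mpr h⟩⟩

/-- In the converse direction invariance serves twice: for the equivariance of `D`, and for the
multiplicativity of the action on `At(P)`. -/
theorem isConnection_iff (ℋ : 𝒳.Connection) (α : ℰ.ConnectionForm) :
    ℰ.IsConnection ℋ α.D ↔
      ℰ.actionGroupoid.IsForm (ℰ.pullback ℋ.toSourceComplement) α.toFun :=
  ⟨fun h => (ℰ.isEquivariantSplitting_iff ℋ α).mp h.splitting, fun h =>
    have hAt := ℰ.isVectorBundle_at ℋ α h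
    ⟨ℋ.isVectorBundle_tangent, hAt, ℰ.isVectorBundle_ad ℋ.toSourceComplement hAt,
      (ℰ.isEquivariantSplitting_iff ℋ α).mpr h⟩⟩

end LieGroupoid.PrincipalBundle
end Groupoid

theorem mainTheorem4
    {E₁ : Type*} [NormedAddCommGroup E₁] [NormedSpace ℝ E₁] [FiniteDimensional ℝ E₁]
    {E₀ : Type*} [NormedAddCommGroup E₀] [NormedSpace ℝ E₀] [FiniteDimensional ℝ E₀]
    {EP : Type*} [NormedAddCommGroup EP] [NormedSpace ℝ EP] [FiniteDimensional ℝ EP]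
    {EG : Type*} [NormedAddCommGroup EG] [NormedSpace ℝ EG] [FiniteDimensional ℝ EG]
    {X₁ : Type*} [TopologicalSpace X₁] [ChartedSpace E₁ X₁] [IsManifold 𝓘(ℝ, E₁) ∞ X₁]
    {X₀ : Type*} [TopologicalSpace X₀] [ChartedSpace E₀ X₀] [IsManifold 𝓘(ℝ, E₀) ∞ X₀]
    {P : Type*} [TopologicalSpace P] [ChartedSpace EP P] [IsManifold 𝓘(ℝ, EP) ∞ P]
    {G : Type*} [TopologicalSpace G] [ChartedSpace EG G] [Group G] [LieGroup 𝓘(ℝ, EG) ∞ G]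
    (𝒳 : LieGroupoid E₁ E₀ X₁ X₀) (ℋ : 𝒳.Connection)
    (ℰ : 𝒳.PrincipalBundle EP EG P G) (α : ℰ.ConnectionForm) :
    (ℰ.IsConnection ℋ α.D ↔
      ℰ.actionGroupoid.IsForm (ℰ.pullback ℋ.toSourceComplement) α.toFun) ∧
    (ℰ.IsEquivariantSplitting ℋ α.D ↔
      ℰ.actionGroupoid.IsForm (ℰ.pullback ℋ.toSourceComplement) α.toFun) :=
  ⟨ℰ.isConnection_iff ℋ α, ℰ.isEquivariantSplitting_iff ℋ α⟩
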